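/- Let $p>2$, $\tau\in\mathbb{R}\setminus\{0,1\}$, $v>0$ and $\omega>\frac{v^2}{(\tau^2+1)^2}$. Write $\mathbb{R}_-=(-\infty,0)$ and $\mathbb{R}_+=(0,+\infty)$, and let $$H^1_\tau(\mathbb{R})=\{u\in H^1(\mathbb{R}_-)\oplus H^1(\mathbb{R}_+) : u(0_+)=\tau u(0_-)\},$$ where the functions are real-valued or complex-valued and $u(0_\pm)$ are the one-sided limits at $0$ of the continuous representatives of $u$ on the two half-lines. For $u\in H^1_\tau(\mathbb{R})$ put $$S_{\omega,\tau}(u)=\frac12\left(\|u'\|^2_{L^2(\mathbb{R}_-)}+\|u'\|^2_{L^2(\mathbb{R}_+)}\right)-\frac1p\|u\|^p_{L^p(\mathbb{R})}-\frac v2|u(0_-)|^2+\frac\omega2\|u\|^2_{L^2(\mathbb{R})},$$ $$I_{\omega,\tau}(u)=\|u'\|^2_{L^2(\mathbb{R}_-)}+\|u'\|^2_{L^2(\mathbb{R}_+)}-\|u\|^p_{L^p(\mathbb{R})}-v|u(0_-)|^2+\omega\|u\|^2_{L^2(\mathbb{R})}.$$ Then there exists $u\in H^1_\tau(\mathbb{R})\setminus\{0\}$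 with $I_{\omega,\tau}(u)=0$ such that $S_{\omega,\tau}(u)\le S_{\omega,\tau}(w)$ for every $w\in H^1_\tau(\mathbb{R})\setminus\{0\}$ with $I_{\omega,\tau}(w)=0$. That is, $S_{\omega,\tau}$ attains its infimum on the Nehari set $\{u\in H^1_\tau(\mathbb{R})\setminus\{0\} : I_{\omega,\tau}(u)=0\}$. The result holds both for real-valued and for complex-valued functions. -/

import Mathlib

open MeasureTheory Set Filter Topology

namespace FulopTsutsui

noncomputable section

/-- `g` is a weak derivative of `u` on the open set `Ω ⊆ ℝ`:
`∫_Ω φ' u = - ∫_Ω φ g` for every smooth test function `φ` with compact support in `Ω`. -/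
def IsWeakDeriv {𝕜 : Type*} [RCLike 𝕜] (Ω : Set ℝ) (u g : ℝ → 𝕜) : Prop :=
  ∀ φ : ℝ → ℝ, ContDiff ℝ (⊤ : ℕ∞) φ → HasCompactSupport φ → tsupport φ ⊆ Ω →
    ∫ x in Ω, deriv φ x • u x = -∫ x in Ω, φ x • g x

/-- The restriction of `u` to `Ω` belongs to the Sobolev space `H¹(Ω)`: `u` is in `L²(Ω)` and has a
weak derivative in `L²(Ω)`. -/
def MemH1 {𝕜 : Type*} [RCLike 𝕜] (Ω : Set ℝ) (u : ℝ → 𝕜) : Prop :=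
  MemLp u 2 (volume.restrict Ω) ∧
    ∃ g : ℝ → 𝕜, MemLp g 2 (volume.restrict Ω) ∧ IsWeakDeriv Ω u g

open Classical in
/-- The weak derivative `u'` in `L²(Ω)` of a function `u` in `H¹(Ω)`. It is determined almost
everywhere on `Ω`; see `weakDeriv_ae_eq`. -/
def weakDeriv {𝕜 : Type*} [RCLike 𝕜] (Ω : Set ℝ) (u : ℝ → 𝕜) : ℝ → 𝕜 :=
  if h : ∃ g : ℝ → 𝕜, MemLp g 2 (volume.restrict Ω) ∧ IsWeakDeriv Ω u g then h.choose else 0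

/-- `c` is the boundary value of `u` at `a` from within `Ω`: the continuous representative of `u`
on `Ω` tends to `c` at `a`. -/
def HasTrace {𝕜 : Type*} [RCLike 𝕜] (Ω : Set ℝ) (u : ℝ → 𝕜) (a : ℝ) (c : 𝕜) : Prop :=
  ∃ w : ℝ → 𝕜, ContinuousOn w Ω ∧ u =ᵐ[volume.restrict Ω] w ∧ Tendsto w (𝓝[Ω] a) (𝓝 c)

open Classical in
/-- The boundary value of `u` at `a` from within `Ω`. It is unique on half-lines ending
at `a`; see `HasTrace.trace_eq`. -/
def trace {𝕜 : Type*} [RCLike 𝕜] (Ω : Set ℝ) (u : ℝ → 𝕜) (a : ℝ) : 𝕜 :=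
  if h : ∃ c : 𝕜, HasTrace Ω u a c then h.choose else 0

/-- The one-sided value `u(0-)`. -/
abbrev leftValue {𝕜 : Type*} [RCLike 𝕜] (u : ℝ → 𝕜) : 𝕜 := trace (Iio 0) u 0

/-- The space `H¹_τ(ℝ)` of all `u` in `H¹(ℝ₋) ⊕ H¹(ℝ₊)` with `u(0+) = τ u(0-)`; its elements are
functions, and two of them are identified when they agree almost everywhere. -/
def H1tau (𝕜 : Type*) [RCLike 𝕜] (τ : ℝ) : Set (ℝ → 𝕜) :=
  {u | MemH1 (Iio 0) u ∧ MemH1 (Ioi 0) u ∧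
    ∃ c : 𝕜, HasTrace (Iio 0) u 0 c ∧ HasTrace (Ioi 0) u 0 ((τ : 𝕜) * c)}

/-- `‖u'‖²` in `L²(ℝ₋)` plus `‖u'‖²` in `L²(ℝ₊)`. -/
def kinetic {𝕜 : Type*} [RCLike 𝕜] (u : ℝ → 𝕜) : ℝ :=
  (∫ x in Iio 0, ‖weakDeriv (Iio 0) u x‖ ^ 2) + ∫ x in Ioi 0, ‖weakDeriv (Ioi 0) u x‖ ^ 2

/-- The action `S_{ω,τ}`, on the space `H¹_τ(ℝ)`. -/
def action {𝕜 : Type*} [RCLike 𝕜] (p v ω : ℝ) (u : ℝ → 𝕜) : ℝ :=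
  (1 / 2) * kinetic u - (1 / p) * (∫ x, ‖u x‖ ^ p) - (v / 2) * ‖leftValue u‖ ^ 2
    + (ω / 2) * ∫ x, ‖u x‖ ^ 2

/-- The Nehari functional `I_{ω,τ}`, on the space `H¹_τ(ℝ)`. -/
def nehari {𝕜 : Type*} [RCLike 𝕜] (p v ω : ℝ) (u : ℝ → 𝕜) : ℝ :=
  kinetic u - (∫ x, ‖u x‖ ^ p) - v * ‖leftValue u‖ ^ 2 + ω * ∫ x, ‖u x‖ ^ 2

/-- The Nehari set: all `u ≠ 0` in `H¹_τ(ℝ)` with `I_{ω,τ}(u) = 0`. -/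
def nehariSet (𝕜 : Type*) [RCLike 𝕜] (p τ v ω : ℝ) : Set (ℝ → 𝕜) :=
  {u | u ∈ H1tau 𝕜 τ ∧ ¬ (u =ᵐ[volume] 0) ∧ nehari p v ω u = 0}

/-- Weak derivatives in `L²` are unique almost everywhere. -/
theorem IsWeakDeriv.ae_eq {𝕜 : Type*} [RCLike 𝕜] {Ω : Set ℝ} (hΩ : IsOpen Ω) {u g₁ g₂ : ℝ → 𝕜}
    (m₁ : MemLp g₁ 2 (volume.restrict Ω)) (m₂ : MemLp g₂ 2 (volume.restrict Ω))
    (h₁ : IsWeakDeriv Ω u g₁) (h₂ : IsWeakDeriv Ω u g₂) : g₁ =ᵐ[volume.restrict Ω] g₂ := by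
  have l₁ := m₁.locallyIntegrable (by norm_num)
  have l₂ := m₂.locallyIntegrable (by norm_num)
  have h : ∀ᵐ x ∂(volume.restrict Ω), x ∈ Ω → g₁ x - g₂ x = 0 := by
    refine hΩ.ae_eq_zero_of_integral_contDiff_smul_eq_zero
      ((l₁.sub l₂).locallyIntegrableOn Ω) ?_
    intro φ hφ hc hs
    have e := (h₁ φ hφ hc hs).symm.trans (h₂ φ hφ hc hs)
    have i₁ : Integrable (fun x => φ x • g₁ x) (volume.restrict Ω) :=
      l₁.integrable_smul_left_of_hasCompactSupport hφ.continuous hc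
    have i₂ : Integrable (fun x => φ x • g₂ x) (volume.restrict Ω) :=
      l₂.integrable_smul_left_of_hasCompactSupport hφ.continuous hc
    simp only [smul_sub]
    rw [integral_sub i₁ i₂, neg_injective e, sub_self]
  filter_upwards [h, ae_restrict_mem hΩ.measurableSet] with x hx hm
  exact sub_eq_zero.mp (hx hm)

/-- Every weak derivative in `L²(Ω)` agrees with `weakDeriv`. -/
theorem weakDeriv_ae_eq {𝕜 : Type*} [RCLike 𝕜] {Ω : Set ℝ} (hΩ : IsOpen Ω) {u g : ℝ → 𝕜}
    (m : MemLp g 2 (volume.restrict Ω)) (h : IsWeakDeriv Ω u g) :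
    weakDeriv Ω u =ᵐ[volume.restrict Ω] g := by
  have ex : ∃ g : ℝ → 𝕜, MemLp g 2 (volume.restrict Ω) ∧ IsWeakDeriv Ω u g := ⟨g, m, h⟩
  rw [weakDeriv, dif_pos ex]
  exact IsWeakDeriv.ae_eq hΩ ex.choose_spec.1 m ex.choose_spec.2 h

/-- Boundary values are unique. -/
theorem HasTrace.unique {𝕜 : Type*} [RCLike 𝕜] {Ω : Set ℝ} (hΩ : IsOpen Ω) {u : ℝ → 𝕜} {a : ℝ}
    {c₁ c₂ : 𝕜} (ha : a ∈ closure Ω) (h₁ : HasTrace Ω u a c₁) (h₂ : HasTrace Ω u a c₂) :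
    c₁ = c₂ := by
  obtain ⟨w₁, k₁, e₁, t₁⟩ := h₁
  obtain ⟨w₂, k₂, e₂, t₂⟩ := h₂
  have e : EqOn w₁ w₂ Ω :=
    Measure.eqOn_open_of_ae_eq (e₁.symm.trans e₂) hΩ k₁ k₂
  have : (𝓝[Ω] a).NeBot := mem_closure_iff_nhdsWithin_neBot.mp ha
  exact tendsto_nhds_unique (t₁.congr' (e.eventuallyEq_of_mem self_mem_nhdsWithin)) t₂

/-- Every boundary value agrees with `trace`. -/
theorem HasTrace.trace_eq {𝕜 : Type*} [RCLike 𝕜] {Ω : Set ℝ} (hΩ : IsOpen Ω) {u : ℝ → 𝕜} {a : ℝ}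
    {c : 𝕜} (ha : a ∈ closure Ω) (h : HasTrace Ω u a c) : trace Ω u a = c := by
  have ex : ∃ c : 𝕜, HasTrace Ω u a c := ⟨c, h⟩
  rw [trace, dif_pos ex]
  exact HasTrace.unique hΩ ha ex.choose_spec h

end

end FulopTsutsui

/-!
On the Nehari set the action equals `(1/2 - 1/p) ∫ |u|ᵖ`, and rescaling turns its minimization into
that of the quadratic form `Q(u) = ‖u'‖² + ω ‖u‖² - v |u(0-)|²` under the constraint `∫ |u|ᵖ = 1`.
A function on the line is treated as a pair of functions in `H¹(0, ∞)`, the left half being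
reflected (`Represents`, `Matching`).

The sharp trace inequality `√ω |f(0)|² ≤ ∫ |f'|² + ω |f|²` (`HalfLineH1.mul_norm_sq_le_energy`) on
both halves, together with `v < √ω (1 + τ²)`, makes `Q` coercive. A minimizing sequence is therefore
bounded and has a subsequence along which energy and mass split into those of the limit and those of
a remainder (`HalfLineH1.exists_subseq_splitting`). The boundary values of the remainder tend to
zero, so its mass is paid for at the level `D` (`dirichletLevel`) of functions vanishing at the
vertex. If `C` denotes the infimum of `Q` (`nehariLevel`) and `θ` the mass of the limit, then
`C ≥ C θ ^ (2 / p) + D (1 - θ) ^ (2 / p)`, and concavity forces `θ = 1` provided that `C < D`.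

The strict inequality (`nehariLevel_lt_dirichletLevel`) needs no explicit solitons. A nearly optimal
function for `D` is cut where it has half of its mass; the cheaper half, moved to the vertex as `G`,
yields the trial pair `(G, τ G)`. By the power mean inequality its quotient exceeds `D` by no more
than the optimality defect, minus a positive multiple of `|G(0)|²`. So `C ≥ D` would force `G(0)` to
tend to zero, and then half of the mass could be had for half of the level `D`, contrary to the
strict concavity of `m ↦ m ^ (2 / p)`.
-/

namespace FulopTsutsui

/-! ### Primitives of integrable functions -/

section Primitive

variable {E : Type*} [NormedAddCommGroup E] [NormedSpace ℝ E]

/-- A primitive of an interval integrable function with values in a normed space is absolutely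
continuous: its oscillation is dominated by that of a primitive of the norm. -/
theorem absolutelyContinuousOnInterval_primitive {g : ℝ → E} {a b c : ℝ}
    (hg : IntervalIntegrable g volume a b) (hc : c ∈ uIcc a b) :
    AbsolutelyContinuousOnInterval (fun x => ∫ t in c..x, g t) a b := by
  have hG := hg.norm.absolutelyContinuousOnInterval_intervalIntegral hc
  have sub : ∀ x ∈ uIcc a b, ∀ y ∈ uIcc a b, IntervalIntegrable g volume x y := fun x hx y hy =>
    hg.mono_set (uIcc_subset_uIcc hx hy)
  rw [absolutelyContinuousOnInterval_iff] at hG ⊢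
  intro ε hε
  obtain ⟨δ, hδ, h⟩ := hG ε hε
  refine ⟨δ, hδ, fun I hI hI' => lt_of_le_of_lt (Finset.sum_le_sum fun i hi => ?_) (h I hI hI')⟩
  have h1 := (hI.1 i hi).1
  have h2 := (hI.1 i hi).2
  rw [dist_comm, dist_eq_norm, dist_comm, dist_eq_norm,
    intervalIntegral.integral_interval_sub_left (sub _ hc _ h2) (sub _ hc _ h1),
    intervalIntegral.integral_interval_sub_left (sub _ hc _ h2).norm (sub _ hc _ h1).norm]
  exact intervalIntegral.norm_integral_le_abs_integral_norm

/-- The product of a `C¹` scalar function with a primitive of an integrable function satisfies the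
fundamental theorem of calculus. -/
theorem integral_deriv_smul_add_smul_primitive [CompleteSpace E] {φ : ℝ → ℝ} (hφ : ContDiff ℝ 1 φ)
    {f g : ℝ → E} {a b : ℝ} (hab : a ≤ b) (hg : IntervalIntegrable g volume a b)
    (hf : ∀ x ∈ Icc a b, f x = f a + ∫ t in a..x, g t) :
    ∫ x in a..b, (deriv φ x • f x + φ x • g x) = φ b • f b - φ a • f a := by
  set F : ℝ → E := fun x => f a + ∫ t in a..x, g t
  have hF : AbsolutelyContinuousOnInterval F a b := by
    have h0 : AbsolutelyContinuousOnInterval (fun _ : ℝ => f a) a b :=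
      (contDiffOn_const (c := f a)).absolutelyContinuousOnInterval
    exact h0.add (absolutelyContinuousOnInterval_primitive hg left_mem_uIcc)
  have hφc : Continuous (deriv φ) := hφ.continuous_deriv le_rfl
  have hi : IntervalIntegrable (fun x => deriv φ x • F x + φ x • g x) volume a b :=
    ((hφc.continuousOn.smul hF.continuousOn).intervalIntegrable).add
      (hg.continuousOn_smul hφ.continuous.continuousOn)
  have hH : AbsolutelyContinuousOnInterval
      (fun x => φ x • F x - ∫ t in a..x, (deriv φ t • F t + φ t • g t)) a b :=
    (hφ.contDiffOn.absolutelyContinuousOnInterval.fun_smul hF).fun_sub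
      (absolutelyContinuousOnInterval_primitive hi left_mem_uIcc)
  obtain ⟨C, hC⟩ := hH.const_of_ae_hasDerivAt_zero (by
    filter_upwards [hg.ae_hasDerivAt_integral, hi.ae_hasDerivAt_integral] with x h1 h2 hx
    have d1 := ((hφ.differentiable one_ne_zero x).hasDerivAt.smul
      ((h1 hx a left_mem_uIcc).const_add (f a))).sub (h2 hx a left_mem_uIcc)
    convert! d1 using 1
    simp only [F]
    abel)
  have ea := hC a left_mem_uIcc
  have eb := hC b right_mem_uIcc
  have efa : F a = f a := by simp [F]
  have efb : F b = f b := (hf b (right_mem_Icc.2 hab)).symm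
  have ei : ∫ x in a..b, (deriv φ x • f x + φ x • g x) =
      ∫ x in a..b, (deriv φ x • F x + φ x • g x) := by
    refine intervalIntegral.integral_congr fun x hx => ?_
    rw [uIcc_of_le hab] at hx
    simp only [F, hf x hx]
  rw [ei]
  simp only [intervalIntegral.integral_same, sub_zero, efa, efb] at ea eb
  rw [ea, ← eb]
  abel

end Primitive

/-! ### Powers of norms -/

theorem abs_rpow_sub_rpow_le {p R x y : ℝ} (hp : 1 ≤ p) (hx : 0 ≤ x) (hy : 0 ≤ y) (hxR : x ≤ R)
    (hyR : y ≤ R) : |x ^ p - y ^ p| ≤ p * R ^ (p - 1) * |x - y| := by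
  have h := (convex_Icc (0 : ℝ) R).norm_image_sub_le_of_norm_hasDerivWithin_le
    (f := fun x => x ^ p) (f' := fun x => p * x ^ (p - 1)) (C := p * R ^ (p - 1))
    (fun z _ => (Real.hasDerivAt_rpow_const (Or.inr hp)).hasDerivWithinAt)
    (fun z hz => by
      have : 0 ≤ z := hz.1
      rw [Real.norm_of_nonneg (by positivity)]
      gcongr
      exact hz.2) ⟨hy, hyR⟩ ⟨hx, hxR⟩
  simpa [Real.norm_eq_abs] using h

/-- On bounded sets the `p`-th power of the norm is additive up to an error controlled by the
product of the norms. -/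
theorem abs_norm_add_rpow_sub_le {E : Type*} [NormedAddCommGroup E] {p M : ℝ} (hp : 2 ≤ p) {a b : E}
    (ha : ‖a‖ ≤ M) (hb : ‖b‖ ≤ M) :
    |‖a + b‖ ^ p - ‖a‖ ^ p - ‖b‖ ^ p| ≤ (p * 2 ^ (p - 1) + 1) * M ^ (p - 2) * (‖a‖ * ‖b‖) := by
  wlog hba : ‖b‖ ≤ ‖a‖ generalizing a b
  · have := this hb ha (le_of_not_ge hba)
    rwa [add_comm b a, sub_right_comm, mul_comm ‖b‖] at this
  have hA := norm_nonneg a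
  have hB := norm_nonneg b
  have hM : 0 ≤ M := hA.trans ha
  have h1 : |‖a + b‖ ^ p - ‖a‖ ^ p| ≤ p * (2 * ‖a‖) ^ (p - 1) * ‖b‖ := by
    refine (abs_rpow_sub_rpow_le (R := 2 * ‖a‖) (by linarith) (norm_nonneg _) hA
      ((norm_add_le a b).trans (by linarith)) (by linarith)).trans ?_
    gcongr
    simpa using abs_norm_sub_norm_le (a + b) a
  have h2 : (2 * ‖a‖) ^ (p - 1) ≤ 2 ^ (p - 1) * (M ^ (p - 2) * ‖a‖) := by
    rw [Real.mul_rpow (by norm_num) hA, show p - 1 = (p - 2) + 1 by ring,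
      Real.rpow_add_of_nonneg hA (by linarith) zero_le_one, Real.rpow_one]
    gcongr
  have h3 : ‖b‖ ^ p ≤ M ^ (p - 2) * (‖a‖ * ‖b‖) := by
    rw [show ‖b‖ ^ p = ‖b‖ ^ (p - 2) * (‖b‖ * ‖b‖) by
      rw [← sq, ← Real.rpow_natCast ‖b‖ 2, ← Real.rpow_add_of_nonneg hB (by linarith) (by norm_num)]
      norm_num]
    gcongr
  have h4 : 0 ≤ ‖b‖ ^ p := by positivity
  calc |‖a + b‖ ^ p - ‖a‖ ^ p - ‖b‖ ^ p| ≤ |‖a + b‖ ^ p - ‖a‖ ^ p| + ‖b‖ ^ p := by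
        refine (abs_sub _ _).trans ?_
        rw [abs_of_nonneg h4]
    _ ≤ p * (2 ^ (p - 1) * (M ^ (p - 2) * ‖a‖)) * ‖b‖ + M ^ (p - 2) * (‖a‖ * ‖b‖) := by
        refine add_le_add (h1.trans ?_) h3
        gcongr
    _ = _ := by ring

/-! ### The Sobolev space of the half-line -/

section Sobolev

variable {𝕜 : Type*} [RCLike 𝕜]

/-- The space `H¹(0, ∞)`, encoded by pairs `(f, g)` of square integrable functions such that `f` is
the primitive of `g` on `[0, ∞)`; thus `f` is the continuous representative and `g` its weak
derivative. Values on `(-∞, 0)` are irrelevant. -/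
def halfLineH1 (𝕜 : Type*) [RCLike 𝕜] : Submodule 𝕜 ((ℝ → 𝕜) × (ℝ → 𝕜)) where
  carrier := {F | MemLp F.1 2 (volume.restrict (Ioi 0)) ∧ MemLp F.2 2 (volume.restrict (Ioi 0)) ∧
    ∀ x, 0 ≤ x → F.1 x = F.1 0 + ∫ t in (0 : ℝ)..x, F.2 t}
  zero_mem' := ⟨MemLp.zero, MemLp.zero, by simp⟩
  add_mem' := by
    rintro F G ⟨hF1, hF2, hF⟩ ⟨hG1, hG2, hG⟩
    refine ⟨hF1.add hG1, hF2.add hG2, fun x hx => ?_⟩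
    have key : ∀ {g : ℝ → 𝕜}, MemLp g 2 (volume.restrict (Ioi 0)) →
        IntervalIntegrable g volume 0 x := fun {g} hg => by
      rw [intervalIntegrable_iff_integrableOn_Ioc_of_le hx]
      exact (hg.mono_measure (Measure.restrict_mono Ioc_subset_Ioi_self le_rfl)).integrable
        (by norm_num)
    simp only [Prod.fst_add, Prod.snd_add, Pi.add_apply]
    rw [hF x hx, hG x hx, intervalIntegral.integral_add (key hF2) (key hG2)]
    abel
  smul_mem' := by
    rintro c F ⟨hF1, hF2, hF⟩
    refine ⟨hF1.const_smul c, hF2.const_smul c, fun x hx => ?_⟩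
    simp only [Prod.smul_fst, Prod.smul_snd, Pi.smul_apply]
    rw [hF x hx, intervalIntegral.integral_smul, smul_add]

theorem intervalIntegrable_of_memLp {g : ℝ → 𝕜}
    (hg : MemLp g 2 (volume.restrict (Ioi 0))) {a b : ℝ} (ha : 0 ≤ a) (hb : 0 ≤ b) :
    IntervalIntegrable g volume a b := by
  rw [intervalIntegrable_iff]
  have hs : uIoc a b ⊆ Ioi 0 := fun x hx => lt_of_le_of_lt (le_min ha hb) hx.1
  have : IsFiniteMeasure (volume.restrict (uIoc a b)) := ⟨by simp [uIoc]⟩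
  exact (hg.mono_measure (Measure.restrict_mono hs le_rfl)).integrable (by norm_num)

/-- The elements of `H¹(0, ∞)`. -/
abbrev HalfLineH1 (𝕜 : Type*) [RCLike 𝕜] : Type _ := halfLineH1 𝕜

namespace HalfLineH1

theorem memLp (F : HalfLineH1 𝕜) : MemLp F.1.1 2 (volume.restrict (Ioi 0)) := F.2.1

theorem memLp_deriv (F : HalfLineH1 𝕜) : MemLp F.1.2 2 (volume.restrict (Ioi 0)) := F.2.2.1

theorem eq_add_integral (F : HalfLineH1 𝕜) {x : ℝ} (hx : 0 ≤ x) :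
    F.1.1 x = F.1.1 0 + ∫ t in (0 : ℝ)..x, F.1.2 t := F.2.2.2 x hx

theorem eq_add_integral' (F : HalfLineH1 𝕜) {a x : ℝ} (ha : 0 ≤ a) (hx : 0 ≤ x) :
    F.1.1 x = F.1.1 a + ∫ t in a..x, F.1.2 t := by
  rw [F.eq_add_integral hx, F.eq_add_integral ha, add_assoc,
    intervalIntegral.integral_add_adjacent_intervals]
  · exact intervalIntegrable_of_memLp F.memLp_deriv le_rfl ha
  · exact intervalIntegrable_of_memLp F.memLp_deriv ha hx

theorem continuousOn (F : HalfLineH1 𝕜) : ContinuousOn F.1.1 (Ici 0) := by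
  intro x hx
  have hx' : 0 ≤ x := hx
  have h1 : ContinuousOn (fun y => F.1.1 0 + ∫ t in (0 : ℝ)..y, F.1.2 t) (Icc 0 (x + 1)) := by
    have := (absolutelyContinuousOnInterval_primitive
      (intervalIntegrable_of_memLp F.memLp_deriv le_rfl (by linarith : 0 ≤ x + 1))
        left_mem_uIcc).continuousOn
    rw [uIcc_of_le (by linarith)] at this
    exact this.const_add _
  have h2 : ContinuousOn F.1.1 (Icc 0 (x + 1)) :=
    h1.congr fun y hy => F.eq_add_integral hy.1
  refine (h2 x ⟨hx', by linarith⟩).mono_of_mem_nhdsWithin ?_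
  rw [← Ici_inter_Iic]
  exact inter_mem self_mem_nhdsWithin (mem_nhdsWithin_of_mem_nhds (Iic_mem_nhds (by linarith)))

theorem integrable_sq (F : HalfLineH1 𝕜) : IntegrableOn (fun x => ‖F.1.1 x‖ ^ 2) (Ioi 0) :=
  (memLp_two_iff_integrable_sq_norm F.memLp.1).1 F.memLp

theorem integrable_sq_deriv (F : HalfLineH1 𝕜) : IntegrableOn (fun x => ‖F.1.2 x‖ ^ 2) (Ioi 0) :=
  (memLp_two_iff_integrable_sq_norm F.memLp_deriv.1).1 F.memLp_deriv

/-- The squared norm `∫ |f'|² + ω |f|²` on `H¹(0, ∞)`. -/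
noncomputable def energy (ω : ℝ) (F : HalfLineH1 𝕜) : ℝ :=
  ∫ x in Ioi 0, (‖F.1.2 x‖ ^ 2 + ω * ‖F.1.1 x‖ ^ 2)

/-- The integral `∫ |f|ᵖ` on the half-line. -/
noncomputable def powInt (p : ℝ) (F : HalfLineH1 𝕜) : ℝ :=
  ∫ x in Ioi 0, ‖F.1.1 x‖ ^ p

theorem integrable_energy (ω : ℝ) (F : HalfLineH1 𝕜) :
    IntegrableOn (fun x => ‖F.1.2 x‖ ^ 2 + ω * ‖F.1.1 x‖ ^ 2) (Ioi 0) :=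
  F.integrable_sq_deriv.add (F.integrable_sq.const_mul ω)

theorem energy_eq (ω : ℝ) (F : HalfLineH1 𝕜) :
    energy ω F = (∫ x in Ioi 0, ‖F.1.2 x‖ ^ 2) + ω * ∫ x in Ioi 0, ‖F.1.1 x‖ ^ 2 := by
  rw [energy, integral_add F.integrable_sq_deriv (F.integrable_sq.const_mul ω), integral_const_mul]

theorem energy_nonneg {ω : ℝ} (hω : 0 ≤ ω) (F : HalfLineH1 𝕜) : 0 ≤ energy ω F :=
  integral_nonneg fun x => by positivity

theorem powInt_nonneg (p : ℝ) (F : HalfLineH1 𝕜) : 0 ≤ powInt p F :=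
  integral_nonneg fun x => by positivity

theorem energy_smul (ω : ℝ) (c : 𝕜) (F : HalfLineH1 𝕜) :
    energy ω (c • F) = ‖c‖ ^ 2 * energy ω F := by
  rw [energy, energy, ← integral_const_mul]
  congr 1 with x
  simp [mul_pow]
  ring

theorem powInt_smul (p : ℝ) (c : 𝕜) (F : HalfLineH1 𝕜) :
    powInt p (c • F) = ‖c‖ ^ p * powInt p F := by
  rw [powInt, powInt, ← integral_const_mul]
  congr 1 with x
  simp [Real.mul_rpow]

theorem integral_sq_le_energy {ω : ℝ} (F : HalfLineH1 𝕜) :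
    ω * ∫ x in Ioi 0, ‖F.1.1 x‖ ^ 2 ≤ energy ω F := by
  rw [energy_eq]
  have : 0 ≤ ∫ x in Ioi 0, ‖F.1.2 x‖ ^ 2 := integral_nonneg fun x => by positivity
  linarith

theorem integral_sq_deriv_le_energy {ω : ℝ} (hω : 0 ≤ ω) (F : HalfLineH1 𝕜) :
    ∫ x in Ioi 0, ‖F.1.2 x‖ ^ 2 ≤ energy ω F := by
  rw [energy_eq]
  have : 0 ≤ ∫ x in Ioi 0, ‖F.1.1 x‖ ^ 2 := integral_nonneg fun x => by positivity
  nlinarith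

theorem integrable_mul_norm (F G : HalfLineH1 𝕜) :
    IntegrableOn (fun x => ‖F.1.1 x‖ * ‖G.1.1 x‖) (Ioi 0) :=
  F.memLp.norm.integrable_mul G.memLp.norm

theorem norm_le_add_integral_sq (F : HalfLineH1 𝕜) {b : ℝ} (hb : 0 ≤ b) :
    ‖F.1.1 b‖ ≤ ‖F.1.1 0‖ + (b + ∫ x in Ioi 0, ‖F.1.2 x‖ ^ 2) := by
  rw [F.eq_add_integral hb]
  refine (norm_add_le _ _).trans ?_
  gcongr
  rw [intervalIntegral.integral_of_le hb]
  have hi : IntegrableOn (fun x => ‖F.1.2 x‖ ^ 2) (Ioc 0 b) :=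
    F.integrable_sq_deriv.mono_set Ioc_subset_Ioi_self
  have hi2 : IntegrableOn F.1.2 (Ioc 0 b) :=
    (intervalIntegrable_of_memLp F.memLp_deriv le_rfl hb).1
  calc ‖∫ t in Ioc 0 b, F.1.2 t‖ ≤ ∫ t in Ioc 0 b, ‖F.1.2 t‖ := norm_integral_le_integral_norm _
    _ ≤ ∫ t in Ioc 0 b, (1 + ‖F.1.2 t‖ ^ 2) := by
        refine integral_mono hi2.norm ((integrable_const _).add hi) fun x => ?_
        simp only
        nlinarith [sq_nonneg (‖F.1.2 x‖ - 1), norm_nonneg (F.1.2 x)]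
    _ = b + ∫ t in Ioc 0 b, ‖F.1.2 t‖ ^ 2 := by
        rw [integral_add (integrable_const _) hi]
        simp [hb]
    _ ≤ b + ∫ x in Ioi 0, ‖F.1.2 x‖ ^ 2 := by
        exact add_le_add le_rfl (setIntegral_mono_set F.integrable_sq_deriv
          (ae_of_all _ fun x => by positivity) (Eventually.of_forall Ioc_subset_Ioi_self))

theorem memLp_exp {κ : ℝ} (hκ : 0 < κ) :
    MemLp (fun x : ℝ => Real.exp (-κ * x)) 2 (volume.restrict (Ioi 0)) := by
  refine (memLp_two_iff_integrable_sq (by fun_prop)).2 ?_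
  have := integrableOn_exp_mul_Ioi (a := -(2 * κ)) (by linarith) 0
  refine this.congr (ae_of_all _ fun x => ?_)
  simp only [← Real.exp_nat_mul]
  congr 1
  push_cast
  ring

/-- The value at the endpoint is the pairing of `κ f - f'` with a decaying exponential. -/
theorem apply_zero_eq_integral {κ : ℝ} (hκ : 0 < κ) (F : HalfLineH1 𝕜) :
    -F.1.1 0 = ∫ x in Ioi 0,
      ((-κ * Real.exp (-κ * x)) • F.1.1 x + Real.exp (-κ * x) • F.1.2 x) := by
  have hint : IntegrableOn (fun x : ℝ =>
      (-κ * Real.exp (-κ * x)) • F.1.1 x + Real.exp (-κ * x) • F.1.2 x) (Ioi 0) := by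
    have h1 : IntegrableOn (fun x : ℝ => Real.exp (-κ * x) • F.1.1 x) (Ioi 0) :=
      memLp_one_iff_integrable.1 (F.memLp.smul (memLp_exp hκ))
    have h2 : IntegrableOn (fun x : ℝ => Real.exp (-κ * x) • F.1.2 x) (Ioi 0) :=
      memLp_one_iff_integrable.1 (F.memLp_deriv.smul (memLp_exp hκ))
    simp only [mul_smul]
    exact (h1.smul (-κ)).add h2
  have hlim := intervalIntegral_tendsto_integral_Ioi 0 hint tendsto_id
  have hb : Tendsto (fun b : ℝ => Real.exp (-κ * b) • F.1.1 b) atTop (𝓝 0) := by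
    set C := ‖F.1.1 0‖ + ∫ x in Ioi 0, ‖F.1.2 x‖ ^ 2
    have h0 := (tendsto_rpow_mul_exp_neg_mul_atTop_nhds_zero 0 κ hκ).const_mul C
    have h1 := tendsto_rpow_mul_exp_neg_mul_atTop_nhds_zero 1 κ hκ
    have h2 := h0.add h1
    simp only [Real.rpow_zero, one_mul, Real.rpow_one, mul_zero, add_zero] at h2
    refine squeeze_zero_norm' ?_ h2
    filter_upwards [eventually_ge_atTop 0] with b hb
    rw [norm_smul, Real.norm_of_nonneg (Real.exp_nonneg _), ← add_mul, mul_comm]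
    gcongr
    linarith [F.norm_le_add_integral_sq hb]
  have heq : ∀ᶠ b : ℝ in atTop, ∫ x in (0 : ℝ)..id b,
      ((-κ * Real.exp (-κ * x)) • F.1.1 x + Real.exp (-κ * x) • F.1.2 x) =
        Real.exp (-κ * b) • F.1.1 b - F.1.1 0 := by
    filter_upwards [eventually_ge_atTop 0] with b hb
    have h := integral_deriv_smul_add_smul_primitive (φ := fun x => Real.exp (-κ * x))
      (by fun_prop) hb (intervalIntegrable_of_memLp F.memLp_deriv le_rfl hb)
      (fun x hx => F.eq_add_integral hx.1)
    have hd : ∀ x, deriv (fun x => Real.exp (-κ * x)) x = -κ * Real.exp (-κ * x) := fun x => by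
      have := ((hasDerivAt_id x).const_mul (-κ)).exp.deriv
      simp only [id] at this
      rw [this]
      ring
    simp only [hd, mul_zero, Real.exp_zero, one_smul] at h
    exact h
  have := tendsto_nhds_unique (hlim.congr' heq) (hb.sub_const _)
  rw [this, zero_sub]

/-- The sharp trace inequality. -/
theorem mul_norm_sq_le_energy_sq {κ : ℝ} (hκ : 0 < κ) (F : HalfLineH1 𝕜) :
    κ * ‖F.1.1 0‖ ^ 2 ≤ energy (κ ^ 2) F := by
  rcases eq_or_ne (F.1.1 0) 0 with h0 | h0
  · simpa [h0] using F.energy_nonneg (sq_nonneg κ)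
  have hpos : 0 < ‖F.1.1 0‖ := norm_pos_iff.2 h0
  set c := ‖F.1.1 0‖
  have hexp : IntegrableOn (fun x => Real.exp (-(2 * κ) * x)) (Ioi 0) :=
    integrableOn_exp_mul_Ioi (by linarith) 0
  -- Young's inequality with the weight that makes the final inequality homogeneous
  have h1 : c ≤ ∫ x in Ioi 0, ((‖F.1.2 x‖ ^ 2 + κ ^ 2 * ‖F.1.1 x‖ ^ 2) * (1 / (2 * κ * c))
      + (κ * c) * Real.exp (-(2 * κ) * x)) := by
    have e : c = ‖-F.1.1 0‖ := (norm_neg _).symm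
    refine (e.trans (congrArg norm (F.apply_zero_eq_integral hκ))).le.trans ?_
    refine norm_integral_le_of_norm_le
      (((F.integrable_energy _).mul_const _).add (hexp.const_mul _)) (ae_of_all _ fun x => ?_)
    refine (norm_add_le _ _).trans ?_
    rw [norm_smul, norm_smul, norm_mul, norm_neg, Real.norm_of_nonneg hκ.le,
      Real.norm_of_nonneg (Real.exp_nonneg _)]
    have he : Real.exp (-(2 * κ) * x) = Real.exp (-κ * x) ^ 2 := by
      rw [← Real.exp_nat_mul]
      congr 1
      push_cast
      ring
    rw [he]
    set E := Real.exp (-κ * x)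
    set A := ‖F.1.2 x‖
    set B := ‖F.1.1 x‖
    have : (A ^ 2 + κ ^ 2 * B ^ 2) * (1 / (2 * κ * c)) + κ * c * E ^ 2 - (κ * E * B + E * A)
        = ((A - κ * B) ^ 2 + (A + κ * B - 2 * κ * c * E) ^ 2) / (4 * κ * c) := by
      field_simp
      ring
    have : 0 ≤ ((A - κ * B) ^ 2 + (A + κ * B - 2 * κ * c * E) ^ 2) / (4 * κ * c) := by positivity
    linarith
  rw [integral_add ((F.integrable_energy _).mul_const _) (hexp.const_mul _), integral_mul_const,
    integral_const_mul, integral_exp_mul_Ioi (by linarith)] at h1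
  change c ≤ energy (κ ^ 2) F * (1 / (2 * κ * c)) + _ at h1
  simp only [mul_zero, Real.exp_zero] at h1
  have h2 := mul_le_mul_of_nonneg_left h1 (by positivity : 0 ≤ 2 * κ * c)
  have h3 : 2 * κ * c * (energy (κ ^ 2) F * (1 / (2 * κ * c)) + κ * c * (-1 / -(2 * κ))) =
      energy (κ ^ 2) F + κ * c ^ 2 := by
    field_simp
  rw [h3] at h2
  nlinarith

/-- Translation of an element of `H¹(0, ∞)` to the left by `a ≥ 0`. -/
def shift (F : HalfLineH1 𝕜) (a : ℝ) (ha : 0 ≤ a) : HalfLineH1 𝕜 :=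
  ⟨(fun x => F.1.1 (x + a), fun x => F.1.2 (x + a)), by
    have key : ∀ g : ℝ → 𝕜, MemLp g 2 (volume.restrict (Ioi 0)) →
        MemLp (fun x => g (x + a)) 2 (volume.restrict (Ioi 0)) := fun g hg => by
      have h := ((measurePreserving_add_right volume a).restrict_preimage
        (measurableSet_Ioi (a := a)))
      have e : (fun x => x + a) ⁻¹' Ioi a = Ioi 0 := by ext; simp
      rw [e] at h
      exact (hg.mono_measure
        (Measure.restrict_mono (Ioi_subset_Ioi ha) le_rfl)).comp_measurePreserving h
    refine ⟨key _ F.memLp, key _ F.memLp_deriv, fun x hx => ?_⟩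
    simp only
    rw [intervalIntegral.integral_comp_add_right, zero_add]
    exact F.eq_add_integral' ha (by linarith)⟩

theorem setIntegral_comp_add_right_Ioi (f : ℝ → ℝ) (a : ℝ) :
    ∫ x in Ioi 0, f (x + a) = ∫ x in Ioi a, f x := by
  have h := (measurePreserving_add_right volume a).setIntegral_preimage_emb
    (measurableEmbedding_addRight a) f (Ioi a)
  have e : (fun x => x + a) ⁻¹' Ioi a = Ioi 0 := by ext; simp
  rwa [e] at h

theorem energy_shift (ω : ℝ) (F : HalfLineH1 𝕜) {a : ℝ} (ha : 0 ≤ a) :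
    energy ω (F.shift a ha) = ∫ x in Ioi a, (‖F.1.2 x‖ ^ 2 + ω * ‖F.1.1 x‖ ^ 2) := by
  exact setIntegral_comp_add_right_Ioi (fun x => ‖F.1.2 x‖ ^ 2 + ω * ‖F.1.1 x‖ ^ 2) a

theorem powInt_shift (p : ℝ) (F : HalfLineH1 𝕜) {a : ℝ} (ha : 0 ≤ a) :
    powInt p (F.shift a ha) = ∫ x in Ioi a, ‖F.1.1 x‖ ^ p := by
  exact setIntegral_comp_add_right_Ioi (fun x => ‖F.1.1 x‖ ^ p) a

theorem mul_norm_sq_le_energy {ω : ℝ} (hω : 0 < ω) (F : HalfLineH1 𝕜) {x : ℝ} (hx : 0 ≤ x) :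
    √ω * ‖F.1.1 x‖ ^ 2 ≤ energy ω F := by
  have h := (F.shift x hx).mul_norm_sq_le_energy_sq (Real.sqrt_pos.2 hω)
  rw [Real.sq_sqrt hω.le, energy_shift] at h
  have e : (F.shift x hx).1.1 0 = F.1.1 x := by simp [shift]
  rw [e] at h
  refine h.trans ?_
  exact setIntegral_mono_set (F.integrable_energy ω) (ae_of_all _ fun x => by positivity)
    (Eventually.of_forall (Ioi_subset_Ioi hx))

@[simp] theorem sub_apply (F G : HalfLineH1 𝕜) (x : ℝ) : (F - G).1.1 x = F.1.1 x - G.1.1 x := rfl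

@[simp] theorem smul_apply (c : 𝕜) (F : HalfLineH1 𝕜) (x : ℝ) : (c • F).1.1 x = c * F.1.1 x := rfl

/-! ### Sobolev bounds and the polar form of the energy -/

theorem norm_apply_le {ω B : ℝ} (hω : 0 < ω) {F : HalfLineH1 𝕜} (hF : energy ω F ≤ B) {x : ℝ}
    (hx : 0 ≤ x) : ‖F.1.1 x‖ ≤ √(B / √ω) := by
  refine Real.le_sqrt_of_sq_le ?_
  rw [le_div_iff₀ (Real.sqrt_pos.2 hω), mul_comm]
  exact (F.mul_norm_sq_le_energy hω hx).trans hF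

theorem norm_rpow_le {p M : ℝ} (hp : 2 ≤ p) {a : 𝕜} (ha : ‖a‖ ≤ M) :
    ‖a‖ ^ p ≤ M ^ (p - 2) * ‖a‖ ^ 2 := by
  have h0 := norm_nonneg a
  have e : ‖a‖ ^ p = ‖a‖ ^ (p - 2) * ‖a‖ ^ 2 := by
    rw [← Real.rpow_natCast ‖a‖ 2, ← Real.rpow_add_of_nonneg h0 (by linarith) (by norm_num)]
    norm_num
  rw [e]
  gcongr

theorem integrable_rpow {p : ℝ} (hp : 2 ≤ p) (F : HalfLineH1 𝕜) :
    IntegrableOn (fun x => ‖F.1.1 x‖ ^ p) (Ioi 0) := by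
  refine (F.integrable_sq.const_mul (√(energy 1 F / √1) ^ (p - 2))).mono'
    (F.memLp.1.norm.aemeasurable.pow_const p).aestronglyMeasurable ?_
  filter_upwards [ae_restrict_mem measurableSet_Ioi] with x hx
  rw [Real.norm_of_nonneg (by positivity)]
  exact norm_rpow_le hp (norm_apply_le one_pos le_rfl (le_of_lt hx))

theorem powInt_le {p ω B : ℝ} (hp : 2 ≤ p) (hω : 0 < ω) {F : HalfLineH1 𝕜} (hF : energy ω F ≤ B) :
    powInt p F ≤ √(B / √ω) ^ (p - 2) * (B / ω) := by
  have h1 : powInt p F ≤ ∫ x in Ioi 0, √(B / √ω) ^ (p - 2) * ‖F.1.1 x‖ ^ 2 := by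
    refine integral_mono_ae (F.integrable_rpow hp) (F.integrable_sq.const_mul _) ?_
    filter_upwards [ae_restrict_mem measurableSet_Ioi] with x hx
    exact norm_rpow_le hp (norm_apply_le hω hF (le_of_lt hx))
  rw [integral_const_mul] at h1
  refine h1.trans ?_
  gcongr
  rw [le_div_iff₀ hω, mul_comm]
  exact F.integral_sq_le_energy.trans hF

theorem exists_powInt_lt_of_energy_le {p ω : ℝ} (hp : 2 < p) (hω : 0 < ω) {ε : ℝ} (hε : 0 < ε) :
    ∃ c > 0, ∀ F : HalfLineH1 𝕜, energy ω F ≤ c → powInt p F < ε := by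
  have hcont : Tendsto (fun B => √(B / √ω) ^ (p - 2) * (B / ω)) (𝓝[>] 0) (𝓝 0) := by
    have h : Continuous fun B : ℝ => √(B / √ω) ^ (p - 2) * (B / ω) :=
      (Continuous.rpow_const (by fun_prop) fun _ => Or.inr (by linarith)).mul (by fun_prop)
    simpa using (h.tendsto 0).mono_left nhdsWithin_le_nhds
  obtain ⟨c, hc, hc0⟩ := ((hcont.eventually_lt_const hε).and self_mem_nhdsWithin).exists
  exact ⟨c, hc0, fun F hF => (powInt_le hp.le hω hF).trans_lt hc⟩

theorem integrable_inner {f g : ℝ → 𝕜} (hf : MemLp f 2 (volume.restrict (Ioi 0)))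
    (hg : MemLp g 2 (volume.restrict (Ioi 0))) :
    IntegrableOn (fun x => RCLike.re (inner 𝕜 (f x) (g x))) (Ioi 0) := by
  refine (hf.norm.integrable_mul hg.norm).mono' (hf.1.inner hg.1).re (ae_of_all _ fun x => ?_)
  exact (RCLike.norm_re_le_norm _).trans (norm_inner_le_norm _ _)

/-- The polar form of the energy. -/
noncomputable def pairing (ω : ℝ) (F G : HalfLineH1 𝕜) : ℝ :=
  (∫ x in Ioi 0, RCLike.re (inner 𝕜 (F.1.2 x) (G.1.2 x)))
    + ω * ∫ x in Ioi 0, RCLike.re (inner 𝕜 (F.1.1 x) (G.1.1 x))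

theorem energy_add (ω : ℝ) (F G : HalfLineH1 𝕜) :
    energy ω (F + G) = energy ω F + energy ω G + 2 * pairing ω F G := by
  have key : ∀ {f g : ℝ → 𝕜}, MemLp f 2 (volume.restrict (Ioi 0)) →
      MemLp g 2 (volume.restrict (Ioi 0)) → ∫ x in Ioi 0, ‖f x + g x‖ ^ 2 =
        (∫ x in Ioi 0, ‖f x‖ ^ 2) + 2 * (∫ x in Ioi 0, RCLike.re (inner 𝕜 (f x) (g x)))
          + ∫ x in Ioi 0, ‖g x‖ ^ 2 := fun {f g} hf hg => by
    have h1 := (memLp_two_iff_integrable_sq_norm hf.1).1 hf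
    have h2 := (memLp_two_iff_integrable_sq_norm hg.1).1 hg
    have h3 : IntegrableOn (fun x => ‖f x‖ ^ 2 + 2 * RCLike.re (inner 𝕜 (f x) (g x))) (Ioi 0) :=
      h1.add ((integrable_inner hf hg).const_mul 2)
    simp only [norm_add_sq (𝕜 := 𝕜)]
    rw [integral_add h3 h2,
      integral_add h1 ((integrable_inner hf hg).const_mul 2), integral_const_mul]
  rw [energy_eq, energy_eq, energy_eq, pairing]
  have e1 := key F.memLp G.memLp
  have e2 := key F.memLp_deriv G.memLp_deriv
  change (∫ x in Ioi 0, ‖F.1.2 x + G.1.2 x‖ ^ 2) + ω * ∫ x in Ioi 0, ‖F.1.1 x + G.1.1 x‖ ^ 2 = _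
  rw [e1, e2]
  ring

theorem abs_integral_inner_le {f g : ℝ → 𝕜} (hf : MemLp f 2 (volume.restrict (Ioi 0)))
    (hg : MemLp g 2 (volume.restrict (Ioi 0))) :
    |∫ x in Ioi 0, RCLike.re (inner 𝕜 (f x) (g x))| ≤ ∫ x in Ioi 0, ‖f x‖ * ‖g x‖ := by
  rw [← Real.norm_eq_abs]
  refine norm_integral_le_of_norm_le (hf.norm.integrable_mul hg.norm) (ae_of_all _ fun x => ?_)
  exact (RCLike.norm_re_le_norm _).trans (norm_inner_le_norm _ _)

theorem energy_neg (ω : ℝ) (F : HalfLineH1 𝕜) : energy ω (-F) = energy ω F := by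
  change ∫ x in Ioi 0, (‖-F.1.2 x‖ ^ 2 + ω * ‖-F.1.1 x‖ ^ 2) = _
  simp only [norm_neg]
  rfl

theorem pairing_neg (ω : ℝ) (F G : HalfLineH1 𝕜) : pairing ω F (-G) = -pairing ω F G := by
  simp only [pairing]
  change (∫ x in Ioi 0, RCLike.re (inner 𝕜 (F.1.2 x) (-G.1.2 x)))
    + ω * ∫ x in Ioi 0, RCLike.re (inner 𝕜 (F.1.1 x) (-G.1.1 x)) = _
  simp only [inner_neg_right, map_neg, integral_neg]
  ring

theorem energy_sub (ω : ℝ) (F G : HalfLineH1 𝕜) :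
    energy ω (F - G) = energy ω F + energy ω G - 2 * pairing ω F G := by
  rw [sub_eq_add_neg, energy_add, energy_neg, pairing_neg]
  ring

theorem energy_sub_le {ω : ℝ} (hω : 0 ≤ ω) (F G : HalfLineH1 𝕜) :
    energy ω (F - G) ≤ 2 * energy ω F + 2 * energy ω G := by
  linarith [energy_nonneg hω (F + G), energy_add ω F G, energy_sub ω F G]

/-- The splitting of the `p`-th power integral, with an explicit error. -/
theorem abs_powInt_add_sub_le {p M : ℝ} (hp : 2 ≤ p) {F G : HalfLineH1 𝕜}
    (hF : ∀ x, 0 ≤ x → ‖F.1.1 x‖ ≤ M) (hG : ∀ x, 0 ≤ x → ‖G.1.1 x‖ ≤ M) :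
    |powInt p (F + G) - powInt p F - powInt p G| ≤
      (p * 2 ^ (p - 1) + 1) * M ^ (p - 2) * ∫ x in Ioi 0, ‖F.1.1 x‖ * ‖G.1.1 x‖ := by
  have hi : IntegrableOn (fun x => ‖(F + G).1.1 x‖ ^ p - ‖F.1.1 x‖ ^ p) (Ioi 0) :=
    ((F + G).integrable_rpow hp).sub (F.integrable_rpow hp)
  rw [powInt, powInt, powInt, ← integral_sub ((F + G).integrable_rpow hp) (F.integrable_rpow hp),
    ← integral_sub hi (G.integrable_rpow hp),
    ← integral_const_mul, ← Real.norm_eq_abs]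
  refine norm_integral_le_of_norm_le ((F.integrable_mul_norm G).const_mul _) ?_
  filter_upwards [ae_restrict_mem measurableSet_Ioi] with x hx
  exact abs_norm_add_rpow_sub_le hp (hF x (le_of_lt hx)) (hG x (le_of_lt hx))

theorem integral_mul_norm_le {ω : ℝ} (hω : 0 < ω) (F G : HalfLineH1 𝕜) :
    ∫ x in Ioi 0, ‖F.1.1 x‖ * ‖G.1.1 x‖ ≤ (energy ω F + energy ω G) / (2 * ω) := by
  have h : ∫ x in Ioi 0, ‖F.1.1 x‖ * ‖G.1.1 x‖ ≤
      ∫ x in Ioi 0, (1 / 2) * (‖F.1.1 x‖ ^ 2 + ‖G.1.1 x‖ ^ 2) := by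
    refine integral_mono (F.integrable_mul_norm G)
      ((F.integrable_sq.add G.integrable_sq).const_mul _) fun x => ?_
    simp only
    nlinarith [sq_nonneg (‖F.1.1 x‖ - ‖G.1.1 x‖)]
  rw [integral_const_mul, integral_add F.integrable_sq G.integrable_sq] at h
  have h1 := F.integral_sq_le_energy (ω := ω)
  have h2 := G.integral_sq_le_energy (ω := ω)
  refine h.trans ?_
  rw [le_div_iff₀ (by positivity)]
  linarith

theorem abs_pairing_le {ω : ℝ} (hω : 0 < ω) (F G : HalfLineH1 𝕜) :
    2 * |pairing ω F G| ≤ energy ω F + energy ω G := by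
  have h1 := energy_add ω F G
  have h2 := energy_sub ω F G
  have n1 := energy_nonneg hω.le (F + G)
  have n2 := energy_nonneg hω.le (F - G)
  rcases abs_cases (pairing ω F G) with ⟨h, _⟩ | ⟨h, _⟩ <;> rw [h] <;> linarith

/-- Pairings with a sequence that is bounded in energy and converges to zero pointwise tend to
zero. The positive part of `|f||wₙ| - δ|wₙ|²` is dominated by `|f|² / (4δ)`. -/
theorem tendsto_integral_mul_norm_zero {ω B : ℝ} (hω : 0 < ω) (F : HalfLineH1 𝕜)
    {w : ℕ → HalfLineH1 𝕜} (hB : ∀ n, energy ω (w n) ≤ B)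
    (hw : ∀ x, 0 ≤ x → Tendsto (fun n => (w n).1.1 x) atTop (𝓝 0)) :
    Tendsto (fun n => ∫ x in Ioi 0, ‖F.1.1 x‖ * ‖(w n).1.1 x‖) atTop (𝓝 0) := by
  have hB0 : 0 ≤ B := (energy_nonneg hω.le (w 0)).trans (hB 0)
  have key : ∀ δ > 0, Tendsto (fun n => ∫ x in Ioi 0,
      max (‖F.1.1 x‖ * ‖(w n).1.1 x‖ - δ * ‖(w n).1.1 x‖ ^ 2) 0) atTop (𝓝 0) := fun δ hδ => by
    have h := tendsto_integral_of_dominated_convergence (μ := volume.restrict (Ioi 0))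
      (F := fun n x => max (‖F.1.1 x‖ * ‖(w n).1.1 x‖ - δ * ‖(w n).1.1 x‖ ^ 2) 0)
      (f := fun _ => (0 : ℝ)) (fun x => ‖F.1.1 x‖ ^ 2 * (1 / (4 * δ))) (fun n => ?_)
      (F.integrable_sq.mul_const _) (fun n => ae_of_all _ fun x => ?_) ?_
    · simpa using h
    · have := (((F.integrable_mul_norm (w n)).sub ((w n).integrable_sq.const_mul δ)).pos_part).1
      exact this
    · rw [Real.norm_of_nonneg (le_max_right _ _)]
      refine max_le ?_ (by positivity)
      have : ‖F.1.1 x‖ ^ 2 * (1 / (4 * δ)) - (‖F.1.1 x‖ * ‖(w n).1.1 x‖ - δ * ‖(w n).1.1 x‖ ^ 2)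
          = (‖F.1.1 x‖ - 2 * δ * ‖(w n).1.1 x‖) ^ 2 / (4 * δ) := by
        field_simp
        ring
      have : 0 ≤ (‖F.1.1 x‖ - 2 * δ * ‖(w n).1.1 x‖) ^ 2 / (4 * δ) := by positivity
      linarith
    · filter_upwards [ae_restrict_mem measurableSet_Ioi] with x hx
      have h := (hw x (le_of_lt hx)).norm
      have h2 := ((h.const_mul ‖F.1.1 x‖).sub ((h.pow 2).const_mul δ)).max
        (tendsto_const_nhds (x := (0 : ℝ)))
      simpa using h2
  rw [Metric.tendsto_atTop]
  intro ε hε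
  -- this `δ` makes the discarded term `δ ∫ |wₙ|²` smaller than `ε / 2`
  obtain ⟨N, hN⟩ := Metric.tendsto_atTop.1
    (key (ε * ω / (2 * (B + 1))) (by positivity)) (ε / 2) (by positivity)
  set δ := ε * ω / (2 * (B + 1)) with hδ
  have hδ0 : 0 < δ := by positivity
  refine ⟨N, fun n hn => ?_⟩
  have h1 := hN n hn
  rw [Real.dist_eq, sub_zero] at h1 ⊢
  have hint : IntegrableOn (fun x => max (‖F.1.1 x‖ * ‖(w n).1.1 x‖ - δ * ‖(w n).1.1 x‖ ^ 2) 0)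
      (Ioi 0) := ((F.integrable_mul_norm (w n)).sub ((w n).integrable_sq.const_mul δ)).pos_part
  have h2 : ∫ x in Ioi 0, ‖F.1.1 x‖ * ‖(w n).1.1 x‖ ≤
      ∫ x in Ioi 0, (max (‖F.1.1 x‖ * ‖(w n).1.1 x‖ - δ * ‖(w n).1.1 x‖ ^ 2) 0
        + δ * ‖(w n).1.1 x‖ ^ 2) := by
    refine integral_mono (F.integrable_mul_norm (w n))
      (hint.add ((w n).integrable_sq.const_mul δ)) fun x => ?_
    simp only
    linarith [le_max_left (‖F.1.1 x‖ * ‖(w n).1.1 x‖ - δ * ‖(w n).1.1 x‖ ^ 2) 0]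
  rw [integral_add hint ((w n).integrable_sq.const_mul δ), integral_const_mul] at h2
  have h3 : δ * ∫ x in Ioi 0, ‖(w n).1.1 x‖ ^ 2 < ε / 2 := by
    have h4 := ((w n).integral_sq_le_energy (ω := ω)).trans (hB n)
    have h5 : δ * ∫ x in Ioi 0, ‖(w n).1.1 x‖ ^ 2 =
        ε / (2 * (B + 1)) * (ω * ∫ x in Ioi 0, ‖(w n).1.1 x‖ ^ 2) := by
      rw [hδ]
      ring
    rw [h5]
    calc ε / (2 * (B + 1)) * (ω * ∫ x in Ioi 0, ‖(w n).1.1 x‖ ^ 2) ≤ ε / (2 * (B + 1)) * B := by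
          gcongr
      _ < ε / (2 * (B + 1)) * (B + 1) := by
          gcongr
          linarith
      _ = ε / 2 := by field_simp
  rw [abs_of_nonneg (integral_nonneg fun x => by positivity)]
  linarith [(abs_lt.1 h1).2]

end HalfLineH1

/-! ### Weak compactness -/

/-- Bounded sequences in a separable Hilbert space have weakly convergent subsequences. -/
theorem exists_subseq_tendsto_inner {H : Type*} [NormedAddCommGroup H] [InnerProductSpace 𝕜 H]
    [CompleteSpace H] [TopologicalSpace.SeparableSpace H] {u : ℕ → H} {B : ℝ}
    (hu : ∀ n, ‖u n‖ ≤ B) :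
    ∃ a : H, ∃ φ : ℕ → ℕ, StrictMono φ ∧
      ∀ h : H, Tendsto (fun n => inner 𝕜 (u (φ n)) h) atTop (𝓝 (inner 𝕜 a h)) := by
  obtain ⟨l, -, φ, hφ, hl⟩ := WeakDual.isSeqCompact_closedBall 𝕜 H 0 B
    (x := fun n => StrongDual.toWeakDual (InnerProductSpace.toDual 𝕜 H (u n)))
    (fun n => by simpa using hu n)
  refine ⟨(InnerProductSpace.toDual 𝕜 H).symm (WeakDual.toStrongDual l), φ, hφ, fun h => ?_⟩
  have := (WeakBilin.eval_continuous (topDualPairing 𝕜 H) h).tendsto l |>.comp hl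
  rw [InnerProductSpace.toDual_symm_apply]
  exact this

theorem eLpNorm_two_eq {g : ℝ → 𝕜} {μ : Measure ℝ} (hg : MemLp g 2 μ) :
    eLpNorm g 2 μ = ENNReal.ofReal √(∫ x, ‖g x‖ ^ 2 ∂μ) := by
  rw [hg.eLpNorm_eq_integral_rpow_norm (by norm_num) (by norm_num), Real.sqrt_eq_rpow]
  norm_num

namespace HalfLineH1

/-- Compactness in `H¹(0, ∞)` with splitting: a sequence bounded in energy has a subsequence
converging to some `F`, in the sense that the boundary values converge and that both the energy and
the integral of the `p`-th power split asymptotically into those of `F` and of the remainder. The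
second splitting is an instance of the Brezis–Lieb lemma. -/
theorem exists_subseq_splitting {p ω B : ℝ} (hp : 2 ≤ p) (hω : 0 < ω) {u : ℕ → HalfLineH1 𝕜}
    (hu : ∀ n, energy ω (u n) ≤ B) :
    ∃ F : HalfLineH1 𝕜, ∃ φ : ℕ → ℕ, StrictMono φ ∧
      Tendsto (fun n => (u (φ n)).1.1 0) atTop (𝓝 (F.1.1 0)) ∧
      Tendsto (fun n => energy ω (u (φ n)) - energy ω F - energy ω (u (φ n) - F)) atTop (𝓝 0) ∧
      Tendsto (fun n => powInt p (u (φ n)) - powInt p F - powInt p (u (φ n) - F)) atTop (𝓝 0) := by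
  obtain ⟨c, -, φ, hφ, hc⟩ := tendsto_subseq_of_bounded (x := fun n => (u n).1.1 0)
    (Metric.isBounded_closedBall (x := (0 : 𝕜)) (r := √(B / √ω)))
    (fun n => by simpa using norm_apply_le hω (hu n) le_rfl)
  have : Fact ((2 : ENNReal) ≠ ⊤) := ⟨by norm_num⟩
  obtain ⟨g, ψ, hψ, hg⟩ := exists_subseq_tendsto_inner (𝕜 := 𝕜) (B := √B)
    (u := fun n => (u (φ n)).memLp_deriv.toLp) (fun n => by
      rw [Lp.norm_toLp, eLpNorm_two_eq (u (φ n)).memLp_deriv, ENNReal.toReal_ofReal (by positivity)]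
      exact Real.sqrt_le_sqrt ((integral_sq_deriv_le_energy hω.le _).trans (hu _)))
  set v : ℕ → HalfLineH1 𝕜 := fun n => u (φ (ψ n)) with hv
  have hvB : ∀ n, energy ω (v n) ≤ B := fun n => hu _
  -- only the derivatives need a weak limit; the functions then converge pointwise, since
  -- `∫₀ˣ` is a pairing with an indicator function
  set f : ℝ → 𝕜 := fun x => c + ∫ t in (0 : ℝ)..x, g t
  have hpt : ∀ x, 0 ≤ x → Tendsto (fun n => (v n).1.1 x) atTop (𝓝 (f x)) := fun x hx => by
    have hs : MeasurableSet (Ioc (0 : ℝ) x) := measurableSet_Ioc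
    have hμ : (volume.restrict (Ioi 0)) (Ioc (0 : ℝ) x) ≠ ⊤ :=
      ((Measure.restrict_apply_le _ _).trans_lt (by simp)).ne
    have h1 := hg (indicatorConstLp 2 hs hμ (1 : 𝕜))
    have e : ∀ h : Lp 𝕜 2 (volume.restrict (Ioi (0 : ℝ))),
        inner 𝕜 h (indicatorConstLp 2 hs hμ (1 : 𝕜)) =
          (starRingEnd 𝕜) (∫ t in (0 : ℝ)..x, h t) := fun h => by
      rw [← inner_conj_symm, L2.inner_indicatorConstLp_one, Measure.restrict_restrict hs,
        inter_eq_left.2 Ioc_subset_Ioi_self, intervalIntegral.integral_of_le hx]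
    simp only [e] at h1
    have h2 := (RCLike.continuous_conj.tendsto _).comp h1
    simp only [Function.comp_def, RCLike.conj_conj] at h2
    have h3 := (hc.comp hψ.tendsto_atTop).add h2
    refine h3.congr fun n => ?_
    rw [(v n).eq_add_integral hx]
    congr 1
    rw [intervalIntegral.integral_of_le hx, intervalIntegral.integral_of_le hx]
    refine integral_congr_ae ?_
    exact ae_restrict_of_ae_restrict_of_subset Ioc_subset_Ioi_self
      ((u (φ (ψ n))).memLp_deriv.coeFn_toLp)
  have hae : ∀ᵐ x ∂(volume.restrict (Ioi (0 : ℝ))), Tendsto (fun n => (v n).1.1 x) atTop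
      (𝓝 (f x)) := by
    filter_upwards [ae_restrict_mem measurableSet_Ioi] with x hx using hpt x (le_of_lt hx)
  -- square integrability of the limit is Fatou's lemma
  have hf : MemLp f 2 (volume.restrict (Ioi 0)) := by
    refine ⟨aestronglyMeasurable_of_tendsto_ae _ (fun n => (v n).memLp.1) hae, ?_⟩
    refine (Lp.eLpNorm_lim_le_liminf_eLpNorm (fun n => (v n).memLp.1) f hae).trans_lt ?_
    refine lt_of_le_of_lt (b := ENNReal.ofReal √(B / ω)) ?_ ENNReal.ofReal_lt_top
    refine liminf_le_of_le (by isBoundedDefault) fun b hb => ?_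
    obtain ⟨n, hn⟩ := hb.exists
    refine hn.trans ?_
    rw [eLpNorm_two_eq (v n).memLp]
    refine ENNReal.ofReal_le_ofReal (Real.sqrt_le_sqrt ?_)
    rw [le_div_iff₀ hω, mul_comm]
    exact (v n).integral_sq_le_energy.trans (hvB n)
  set F : HalfLineH1 𝕜 := ⟨(f, g), hf, Lp.memLp g, fun x _ => by simp [f]⟩ with hF
  set w : ℕ → HalfLineH1 𝕜 := fun n => v n - F with hw
  have hwB : ∀ n, energy ω (w n) ≤ 2 * B + 2 * energy ω F := fun n =>
    (energy_sub_le hω.le _ _).trans (by linarith [hvB n])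
  have hwpt : ∀ x, 0 ≤ x → Tendsto (fun n => (w n).1.1 x) atTop (𝓝 0) := fun x hx => by
    have := (hpt x hx).sub_const (f x)
    rwa [sub_self] at this
  have hmul := tendsto_integral_mul_norm_zero hω F hwB hwpt
  have hvw : ∀ n, v n = F + w n := fun n => by simp [hw]
  refine ⟨F, φ ∘ ψ, hφ.comp hψ, hpt 0 le_rfl, ?_, ?_⟩
  · have h1 : Tendsto (fun n => ∫ x in Ioi 0, RCLike.re (inner 𝕜 (F.1.1 x) ((w n).1.1 x)))
        atTop (𝓝 0) :=
      squeeze_zero_norm (fun n => abs_integral_inner_le F.memLp (w n).memLp) hmul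
    have h2 : Tendsto (fun n => ∫ x in Ioi 0, RCLike.re (inner 𝕜 (F.1.2 x) ((w n).1.2 x)))
        atTop (𝓝 0) := by
      have h3 := ((RCLike.continuous_re.tendsto _).comp (hg g)).sub_const (RCLike.re (inner 𝕜 g g))
      rw [sub_self] at h3
      refine h3.congr fun n => ?_
      simp only [Function.comp_apply]
      rw [← map_sub, ← inner_sub_left, L2.inner_def, ← integral_re (L2.integrable_inner _ _)]
      refine integral_congr_ae ?_
      filter_upwards [Lp.coeFn_sub ((u (φ (ψ n))).memLp_deriv.toLp) g,
        (u (φ (ψ n))).memLp_deriv.coeFn_toLp] with x e1 e2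
      rw [inner_re_symm, e1, Pi.sub_apply, e2]
      rfl
    have h4 := (h2.add (h1.const_mul ω)).const_mul 2
    simp only [mul_zero, add_zero] at h4
    refine h4.congr fun n => ?_
    change _ = energy ω (v n) - energy ω F - energy ω (w n)
    rw [hvw n, energy_add, pairing]
    ring
  · set M := max √(B / √ω) (max √((2 * B + 2 * energy ω F) / √ω) √(energy ω F / √ω))
    have h5 := hmul.const_mul ((p * 2 ^ (p - 1) + 1) * M ^ (p - 2))
    rw [mul_zero] at h5
    refine squeeze_zero_norm (fun n => ?_) h5
    change |powInt p (v n) - powInt p F - powInt p (w n)| ≤ _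
    rw [hvw n]
    exact abs_powInt_add_sub_le hp
      (fun x hx => (norm_apply_le hω le_rfl hx).trans
        ((le_max_right _ _).trans (le_max_right _ _)))
      (fun x hx => (norm_apply_le hω (hwB n) hx).trans
        ((le_max_left _ _).trans (le_max_right _ _)))

/-! ### Exponentials and correction of the boundary value -/

/-- The exponential `x ↦ exp (-κ x)` as an element of `H¹(0, ∞)`. -/
noncomputable def expDecay (𝕜 : Type*) [RCLike 𝕜] (κ : ℝ) (hκ : 0 < κ) : HalfLineH1 𝕜 :=
  ⟨(fun x => ((Real.exp (-κ * x) : ℝ) : 𝕜), fun x => ((-κ * Real.exp (-κ * x) : ℝ) : 𝕜)),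
    (memLp_exp hκ).ofReal, ((memLp_exp hκ).const_mul (-κ)).ofReal, fun x _ => by
      have hd : ∀ x, HasDerivAt (fun x => Real.exp (-κ * x)) (-κ * Real.exp (-κ * x)) x :=
        fun x => by
          have := ((hasDerivAt_id x).const_mul (-κ)).exp
          simp only [id, mul_one] at this
          rwa [mul_comm] at this
      have h := intervalIntegral.integral_eq_sub_of_hasDerivAt (a := 0) (b := x)
        (fun y _ => hd y) (Continuous.intervalIntegrable (by fun_prop) _ _)
      simp only
      rw [RCLike.intervalIntegral_ofReal, h]
      push_cast
      ring⟩

@[simp] theorem expDecay_apply {κ : ℝ} (hκ : 0 < κ) (x : ℝ) :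
    (expDecay 𝕜 κ hκ).1.1 x = ((Real.exp (-κ * x) : ℝ) : 𝕜) := rfl

theorem pairing_ofReal_smul (ω : ℝ) (F G : HalfLineH1 𝕜) (r : ℝ) :
    pairing ω F ((r : 𝕜) • G) = r * pairing ω F G := by
  simp only [pairing]
  change (∫ x in Ioi 0, RCLike.re (inner 𝕜 (F.1.2 x) ((r : 𝕜) • G.1.2 x)))
    + ω * ∫ x in Ioi 0, RCLike.re (inner 𝕜 (F.1.1 x) ((r : 𝕜) • G.1.1 x)) = _
  simp only [inner_smul_right, RCLike.re_ofReal_mul, integral_const_mul]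
  ring

theorem abs_pairing_smul_le {ω : ℝ} (hω : 0 < ω) (F G : HalfLineH1 𝕜) (c : 𝕜) :
    2 * |pairing ω F (c • G)| ≤ ‖c‖ * (energy ω F + energy ω G) := by
  rcases eq_or_ne c 0 with rfl | hc
  · have := pairing_ofReal_smul ω F G 0
    rw [RCLike.ofReal_zero, zero_mul] at this
    rw [this]
    simp
  have hc' : (‖c‖ : 𝕜) ≠ 0 := by simpa using hc
  have e : c • G = (‖c‖ : 𝕜) • ((c / ‖c‖) • G) := by
    rw [smul_smul, mul_div_cancel₀ _ hc']
  rw [e, pairing_ofReal_smul, abs_mul, abs_norm, mul_left_comm]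
  gcongr
  refine (abs_pairing_le hω _ _).trans_eq ?_
  rw [energy_smul, norm_div, RCLike.norm_ofReal, abs_norm, div_self (norm_ne_zero_iff.2 hc)]
  ring

/-- A sequence bounded in energy whose boundary values tend to zero may be replaced by one with
vanishing boundary values, at no asymptotic cost. -/
theorem exists_zero_boundary {p ω B : ℝ} (hp : 2 < p) (hω : 0 < ω) {u : ℕ → HalfLineH1 𝕜}
    (hu : ∀ n, energy ω (u n) ≤ B) (h0 : Tendsto (fun n => (u n).1.1 0) atTop (𝓝 0)) :
    ∃ w : ℕ → HalfLineH1 𝕜, (∀ n, (w n).1.1 0 = 0) ∧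
      Tendsto (fun n => energy ω (w n) - energy ω (u n)) atTop (𝓝 0) ∧
      Tendsto (fun n => powInt p (w n) - powInt p (u n)) atTop (𝓝 0) := by
  set e : HalfLineH1 𝕜 := expDecay 𝕜 1 one_pos
  have hn := h0.norm
  rw [norm_zero] at hn
  refine ⟨fun n => u n - (u n).1.1 0 • e, fun n => by simp [e], ?_, ?_⟩
  · have h1 := ((hn.pow 2).mul_const (energy ω e)).add (hn.mul_const (B + energy ω e))
    simp only [ne_eq, OfNat.ofNat_ne_zero, not_false_eq_true, zero_pow, zero_mul, add_zero] at h1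
    refine squeeze_zero_norm (fun n => ?_) h1
    have h2 := abs_pairing_smul_le hω (u n) e ((u n).1.1 0)
    rw [energy_sub, energy_smul, Real.norm_eq_abs]
    have h3 : ‖(u n).1.1 0‖ * (energy ω (u n) + energy ω e) ≤
        ‖(u n).1.1 0‖ * (B + energy ω e) := by
      gcongr
      exact hu n
    have h4 : 0 ≤ ‖(u n).1.1 0‖ ^ 2 * energy ω e :=
      mul_nonneg (by positivity) (energy_nonneg hω.le _)
    rw [abs_le]
    constructor <;> rcases abs_le.1 (le_of_mul_le_mul_left (h2.trans (h3.trans_eq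
      (by ring : _ = 2 * (‖(u n).1.1 0‖ * (B + energy ω e) / 2)))) two_pos) with ⟨h5, h6⟩ <;>
      linarith
  · set M := √(B / √ω)
    have hbd : ∀ n, ‖(u n).1.1 0‖ ≤ M := fun n => norm_apply_le hω (hu n) le_rfl
    set K := (p * 2 ^ (p - 1) + 1) * M ^ (p - 2) * ((B + energy ω e) / (2 * ω))
    have hnp : Tendsto (fun n => ‖(u n).1.1 0‖ ^ p) atTop (𝓝 0) := by
      have := hn.rpow_const (p := p) (Or.inr (by linarith))
      rwa [Real.zero_rpow (by linarith)] at this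
    have h1 := (hn.mul_const K).add (hnp.mul_const (powInt p e))
    simp only [zero_mul, add_zero] at h1
    refine squeeze_zero_norm (fun n => ?_) h1
    have h2 := abs_powInt_add_sub_le (M := M) hp.le (F := u n) (G := (-(u n).1.1 0) • e)
      (fun x hx => norm_apply_le hω (hu n) hx) (fun x hx => by
        rw [smul_apply, norm_mul, norm_neg]
        refine (mul_le_of_le_one_right (norm_nonneg _) ?_).trans (hbd n)
        rw [expDecay_apply, RCLike.norm_ofReal, abs_of_nonneg (Real.exp_nonneg _),
          Real.exp_le_one_iff]
        linarith)
    have h3 : ∫ x in Ioi 0, ‖(u n).1.1 x‖ * ‖((-(u n).1.1 0) • e).1.1 x‖ ≤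
        ‖(u n).1.1 0‖ * ((B + energy ω e) / (2 * ω)) := by
      simp only [smul_apply, norm_mul, norm_neg, mul_left_comm _ ‖(u n).1.1 0‖]
      rw [integral_const_mul]
      gcongr
      refine (integral_mul_norm_le hω (u n) e).trans ?_
      gcongr
      exact hu n
    have hneg : (-(u n).1.1 0) • e = -((u n).1.1 0 • e) := neg_smul ((u n).1.1 0) e
    rw [powInt_smul, norm_neg] at h2
    have h4 : (p * 2 ^ (p - 1) + 1) * M ^ (p - 2) *
        (∫ x in Ioi 0, ‖(u n).1.1 x‖ * ‖((-(u n).1.1 0) • e).1.1 x‖) ≤ ‖(u n).1.1 0‖ * K := by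
      refine (mul_le_mul_of_nonneg_left h3 (by positivity)).trans_eq ?_
      simp only [K]
      ring
    have h5 : 0 ≤ ‖(u n).1.1 0‖ ^ p * powInt p e :=
      mul_nonneg (by positivity) (powInt_nonneg _ _)
    rw [Real.norm_eq_abs]
    have h6 := h2.trans h4
    rw [hneg, ← sub_eq_add_neg] at h6
    rw [abs_le] at h6 ⊢
    constructor <;> linarith [h6.1, h6.2]

/-! ### Reflection and bisection -/

theorem memLp_indicator_comp_sub {g : ℝ → 𝕜} (hg : MemLp g 2 (volume.restrict (Ioi 0))) (a : ℝ) :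
    MemLp ((Iic a).indicator fun x => g (a - x)) 2 (volume.restrict (Ioi 0)) := by
  rw [memLp_indicator_iff_restrict measurableSet_Iic, Measure.restrict_restrict measurableSet_Iic,
    inter_comm, Ioi_inter_Iic, ← Measure.restrict_congr_set Ioo_ae_eq_Ioc]
  have h := (Measure.measurePreserving_sub_left volume a).restrict_preimage
    (measurableSet_Ioo (a := 0) (b := a))
  have e : (fun x => a - x) ⁻¹' Ioo 0 a = Ioo 0 a := by
    ext x
    simp only [mem_preimage, mem_Ioo]
    constructor <;> rintro ⟨h1, h2⟩ <;> constructor <;> linarith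
  rw [e] at h
  exact (hg.mono_measure
    (Measure.restrict_mono Ioo_subset_Ioi_self le_rfl)).comp_measurePreserving h

/-- For `F` vanishing at `0`, the part of `F` on `[0, a]`, reflected at `a / 2` and extended by
zero. -/
noncomputable def reflectAt (F : HalfLineH1 𝕜) (h0 : F.1.1 0 = 0) (a : ℝ) (ha : 0 ≤ a) :
    HalfLineH1 𝕜 :=
  ⟨((Iic a).indicator fun x => F.1.1 (a - x), (Iic a).indicator fun x => (-F.1.2) (a - x)),
    memLp_indicator_comp_sub F.memLp a, memLp_indicator_comp_sub F.memLp_deriv.neg a, by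
    have key : ∀ y, 0 ≤ y → y ≤ a → F.1.1 (a - y) = F.1.1 a +
        ∫ t in (0 : ℝ)..y, (Iic a).indicator (fun x => (-F.1.2) (a - x)) t := fun y hy hya => by
      have e : ∫ t in (0 : ℝ)..y, (Iic a).indicator (fun x => (-F.1.2) (a - x)) t =
          ∫ t in (0 : ℝ)..y, (-F.1.2) (a - t) := by
        refine intervalIntegral.integral_congr fun t ht => ?_
        rw [uIcc_of_le hy] at ht
        exact indicator_of_mem (show t ∈ Iic a from ht.2.trans hya) (fun x => (-F.1.2) (a - x))
      rw [e, intervalIntegral.integral_comp_sub_left (-F.1.2), sub_zero,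
        F.eq_add_integral' (sub_nonneg.2 hya) ha]
      simp [intervalIntegral.integral_neg]
    intro x hx
    simp only
    rw [indicator_of_mem (show (0 : ℝ) ∈ Iic a from ha), sub_zero]
    rcases le_or_gt x a with hxa | hxa
    · rw [indicator_of_mem (show x ∈ Iic a from hxa)]
      exact key x hx hxa
    · rw [indicator_of_notMem (by simpa using hxa)]
      have h1 := key a ha le_rfl
      rw [sub_self, h0] at h1
      have h2 : ∫ t in a..x, (Iic a).indicator (fun x => (-F.1.2) (a - x)) t = 0 := by
        rw [intervalIntegral.integral_of_le hxa.le]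
        exact setIntegral_eq_zero_of_forall_eq_zero fun t ht =>
          indicator_of_notMem (by simpa using ht.1) _
      have hi : MemLp ((Iic a).indicator fun x => (-F.1.2) (a - x)) 2 (volume.restrict (Ioi 0)) :=
        memLp_indicator_comp_sub F.memLp_deriv.neg a
      rw [← intervalIntegral.integral_add_adjacent_intervals
        (intervalIntegrable_of_memLp hi le_rfl ha) (intervalIntegrable_of_memLp hi ha hx), h2,
        add_zero]
      exact h1⟩

theorem integral_indicator_comp_sub {a : ℝ} (ha : 0 ≤ a) (h : ℝ → ℝ) :
    ∫ x in Ioi 0, (Iic a).indicator (fun x => h (a - x)) x = ∫ x in (0 : ℝ)..a, h x := by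
  rw [setIntegral_indicator measurableSet_Iic, Ioi_inter_Iic,
    ← intervalIntegral.integral_of_le ha, intervalIntegral.integral_comp_sub_left h]
  simp

theorem energy_reflectAt (ω : ℝ) (F : HalfLineH1 𝕜) (h0 : F.1.1 0 = 0) {a : ℝ} (ha : 0 ≤ a) :
    energy ω (F.reflectAt h0 a ha) =
      ∫ x in (0 : ℝ)..a, (‖F.1.2 x‖ ^ 2 + ω * ‖F.1.1 x‖ ^ 2) := by
  rw [← integral_indicator_comp_sub ha, energy]
  congr 1 with x
  by_cases hx : x ∈ Iic a <;> simp [reflectAt, hx]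

theorem powInt_reflectAt {p : ℝ} (hp : 0 < p) (F : HalfLineH1 𝕜) (h0 : F.1.1 0 = 0) {a : ℝ}
    (ha : 0 ≤ a) :
    powInt p (F.reflectAt h0 a ha) = ∫ x in (0 : ℝ)..a, ‖F.1.1 x‖ ^ p := by
  rw [← integral_indicator_comp_sub ha, powInt]
  congr 1 with x
  by_cases hx : x ∈ Iic a <;> simp [reflectAt, hx, Real.zero_rpow hp.ne']

/-- A function vanishing at the endpoint is cut where it has half of its mass; one of the two pieces
costs at most half of the energy. -/
theorem exists_half {p ω : ℝ} (hp : 2 ≤ p) {F : HalfLineH1 𝕜} (h0 : F.1.1 0 = 0)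
    (hF : powInt p F = 1) :
    ∃ G : HalfLineH1 𝕜, powInt p G = 1 / 2 ∧ energy ω G ≤ energy ω F / 2 := by
  have hi := F.integrable_rpow hp
  have hlim := intervalIntegral_tendsto_integral_Ioi 0 hi tendsto_id
  rw [show (∫ x in Ioi 0, ‖F.1.1 x‖ ^ p) = 1 from hF] at hlim
  obtain ⟨b, hb, hb0⟩ := ((hlim.eventually_const_lt (show (1 / 2 : ℝ) < 1 by norm_num)).and
    (eventually_ge_atTop 0)).exists
  have hint : IntervalIntegrable (fun x => ‖F.1.1 x‖ ^ p) volume 0 b := by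
    rw [intervalIntegrable_iff_integrableOn_Ioc_of_le hb0]
    exact hi.mono_set Ioc_subset_Ioi_self
  have hcont : ContinuousOn (fun a => ∫ x in (0 : ℝ)..a, ‖F.1.1 x‖ ^ p) (Icc 0 b) := by
    have := (absolutelyContinuousOnInterval_primitive hint left_mem_uIcc).continuousOn
    rwa [uIcc_of_le hb0] at this
  obtain ⟨a, ⟨ha, -⟩, hae⟩ := intermediate_value_Icc hb0 hcont
    (show (1 / 2 : ℝ) ∈ Icc _ _ from ⟨by simp, hb.le⟩)
  have split : ∀ {h : ℝ → ℝ}, IntegrableOn h (Ioi 0) →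
      (∫ x in (0 : ℝ)..a, h x) + ∫ x in Ioi a, h x = ∫ x in Ioi 0, h x := fun {h} hh => by
    rw [intervalIntegral.integral_of_le ha, ← setIntegral_union Ioc_disjoint_Ioi_same
      measurableSet_Ioi (hh.mono_set Ioc_subset_Ioi_self) (hh.mono_set (Ioi_subset_Ioi ha)),
      Ioc_union_Ioi_eq_Ioi ha]
  have s1 := split hi
  have s2 := split (F.integrable_energy ω)
  rw [← F.energy_reflectAt ω h0 ha, ← F.energy_shift ω ha] at s2
  rw [← F.powInt_shift p ha] at s1
  change _ = powInt p F at s1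
  change _ = energy ω F at s2
  simp only at hae
  rcases le_total (energy ω (F.reflectAt h0 a ha)) (energy ω (F.shift a ha)) with h | h
  · exact ⟨F.reflectAt h0 a ha, by rw [F.powInt_reflectAt (by linarith) h0 ha, hae], by linarith⟩
  · exact ⟨F.shift a ha, by linarith, by linarith⟩

end HalfLineH1

open HalfLineH1

/-! ### The level of functions vanishing at the vertex -/

theorem HalfLineH1.eq_zero_of_powInt_eq_zero {p : ℝ} (hp : 2 ≤ p) {F : HalfLineH1 𝕜}
    (hF : powInt p F = 0) {x : ℝ} (hx : 0 < x) : F.1.1 x = 0 := by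
  have h := (integral_eq_zero_iff_of_nonneg (fun x => by positivity) (F.integrable_rpow hp)).1 hF
  have h' : F.1.1 =ᵐ[volume.restrict (Ioi 0)] fun _ => 0 := by
    filter_upwards [h] with y hy
    exact norm_eq_zero.1 ((Real.rpow_eq_zero (norm_nonneg _) (by linarith)).1 hy)
  exact Measure.eqOn_open_of_ae_eq h' isOpen_Ioi (F.continuousOn.mono Ioi_subset_Ici_self)
    continuousOn_const hx

/-- The infimum of the energy among normalized functions on the half-line vanishing at `0`. -/
noncomputable def dirichletLevel (𝕜 : Type*) [RCLike 𝕜] (p ω : ℝ) : ℝ :=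
  sInf (energy ω '' {F : HalfLineH1 𝕜 | F.1.1 0 = 0 ∧ powInt p F = 1})

theorem bddBelow_dirichlet {p ω : ℝ} (hω : 0 < ω) :
    BddBelow (energy ω '' {F : HalfLineH1 𝕜 | F.1.1 0 = 0 ∧ powInt p F = 1}) :=
  ⟨0, by rintro _ ⟨F, -, rfl⟩; exact energy_nonneg hω.le F⟩

theorem rpow_neg_inv_rpow_mul {p m : ℝ} (hp : 0 < p) (hm : 0 < m) :
    |m ^ (-(1 / p))| ^ p * m = 1 := by
  rw [abs_of_pos (by positivity), ← Real.rpow_mul hm.le, show -(1 / p) * p = -1 by field_simp,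
    Real.rpow_neg_one, inv_mul_cancel₀ hm.ne']

theorem rpow_neg_inv_sq_mul {p m : ℝ} (hm : 0 < m) :
    |m ^ (-(1 / p))| ^ 2 * m ^ (2 / p) = 1 := by
  rw [sq_abs, ← Real.rpow_natCast, ← Real.rpow_mul hm.le, ← Real.rpow_add hm]
  rw [show -(1 / p) * ((2 : ℕ) : ℝ) + 2 / p = 0 by push_cast; ring, Real.rpow_zero]

theorem nonempty_dirichlet {p : ℝ} (hp : 2 ≤ p) :
    {F : HalfLineH1 𝕜 | F.1.1 0 = 0 ∧ powInt p F = 1}.Nonempty := by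
  set F : HalfLineH1 𝕜 := expDecay 𝕜 1 one_pos - expDecay 𝕜 2 two_pos
  have h0 : F.1.1 0 = 0 := by simp [F]
  have hF : 0 < powInt p F := by
    refine (powInt_nonneg p F).lt_of_ne' fun h => ?_
    have h1 := eq_zero_of_powInt_eq_zero hp h one_pos
    simp only [F, HalfLineH1.sub_apply, expDecay_apply, sub_eq_zero, RCLike.ofReal_inj,
      Real.exp_eq_exp] at h1
    norm_num at h1
  refine ⟨((powInt p F ^ (-(1 / p)) : ℝ) : 𝕜) • F, by simp [h0], ?_⟩
  rw [powInt_smul, RCLike.norm_ofReal]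
  exact rpow_neg_inv_rpow_mul (by linarith) hF

theorem dirichletLevel_pos {p ω : ℝ} (hp : 2 < p) (hω : 0 < ω) : 0 < dirichletLevel 𝕜 p ω := by
  obtain ⟨c, hc, h⟩ := exists_powInt_lt_of_energy_le (𝕜 := 𝕜) hp hω one_pos
  refine hc.trans_le (le_csInf ((nonempty_dirichlet hp.le).image _) ?_)
  rintro _ ⟨F, ⟨-, hF⟩, rfl⟩
  by_contra! hlt
  exact (h F hlt.le).ne hF

theorem dirichletLevel_mul_le {p ω : ℝ} (hp : 2 < p) (hω : 0 < ω) {F : HalfLineH1 𝕜}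
    (h0 : F.1.1 0 = 0) : dirichletLevel 𝕜 p ω * powInt p F ^ (2 / p) ≤ energy ω F := by
  rcases (powInt_nonneg p F).eq_or_lt with hm | hm
  · rw [← hm, Real.zero_rpow (by positivity), mul_zero]
    exact energy_nonneg hω.le F
  set m := powInt p F
  have h : dirichletLevel 𝕜 p ω ≤ energy ω (((m ^ (-(1 / p)) : ℝ) : 𝕜) • F) := by
    refine csInf_le (bddBelow_dirichlet hω) (mem_image_of_mem _ ⟨by simp [h0], ?_⟩)
    rw [powInt_smul, RCLike.norm_ofReal]
    exact rpow_neg_inv_rpow_mul (by linarith) hm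
  rw [energy_smul, RCLike.norm_ofReal] at h
  calc dirichletLevel 𝕜 p ω * m ^ (2 / p)
      ≤ |m ^ (-(1 / p))| ^ 2 * energy ω F * m ^ (2 / p) := by gcongr
    _ = (|m ^ (-(1 / p))| ^ 2 * m ^ (2 / p)) * energy ω F := by ring
    _ = energy ω F := by rw [rpow_neg_inv_sq_mul hm, one_mul]

/-! ### The level of the coupled problem -/

/-- Pairs of functions on the half-line, the first standing for the reflected left half, that
satisfy the matching condition at the vertex. -/
def Matching (τ : ℝ) (P : HalfLineH1 𝕜 × HalfLineH1 𝕜) : Prop :=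
  P.2.1.1 0 = (τ : 𝕜) * P.1.1.1 0

/-- The quadratic part of the action. -/
noncomputable def quadForm (v ω : ℝ) (P : HalfLineH1 𝕜 × HalfLineH1 𝕜) : ℝ :=
  energy ω P.1 + energy ω P.2 - v * ‖P.1.1.1 0‖ ^ 2

/-- The integral of the `p`-th power over both halves. -/
noncomputable def mass (p : ℝ) (P : HalfLineH1 𝕜 × HalfLineH1 𝕜) : ℝ :=
  powInt p P.1 + powInt p P.2

theorem Matching.smul {τ : ℝ} {P : HalfLineH1 𝕜 × HalfLineH1 𝕜} (h : Matching τ P) (c : 𝕜) :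
    Matching τ (c • P) := by
  change c * P.2.1.1 0 = (τ : 𝕜) * (c * P.1.1.1 0)
  rw [show P.2.1.1 0 = (τ : 𝕜) * P.1.1.1 0 from h, mul_left_comm]

theorem quadForm_smul (v ω : ℝ) (c : 𝕜) (P : HalfLineH1 𝕜 × HalfLineH1 𝕜) :
    quadForm v ω (c • P) = ‖c‖ ^ 2 * quadForm v ω P := by
  simp only [quadForm, Prod.smul_fst, Prod.smul_snd, energy_smul, HalfLineH1.smul_apply, norm_mul]
  ring

theorem mass_smul (p : ℝ) (c : 𝕜) (P : HalfLineH1 𝕜 × HalfLineH1 𝕜) :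
    mass p (c • P) = ‖c‖ ^ p * mass p P := by
  simp only [mass, Prod.smul_fst, Prod.smul_snd, powInt_smul]
  ring

theorem mass_nonneg (p : ℝ) (P : HalfLineH1 𝕜 × HalfLineH1 𝕜) : 0 ≤ mass p P :=
  add_nonneg (powInt_nonneg _ _) (powInt_nonneg _ _)

/-- The trace inequality on both halves makes the quadratic form coercive. -/
theorem Matching.exists_coercive {τ v ω : ℝ} (hv : 0 < v) (hω : 0 < ω)
    (hvω : v < √ω * (1 + τ ^ 2)) :
    ∃ κ > 0, ∀ P : HalfLineH1 𝕜 × HalfLineH1 𝕜, Matching τ P →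
      κ * (energy ω P.1 + energy ω P.2) ≤ quadForm v ω P := by
  have hs : 0 < √ω * (1 + τ ^ 2) := by positivity
  refine ⟨1 - v / (√ω * (1 + τ ^ 2)), by rwa [gt_iff_lt, sub_pos, div_lt_one hs], fun P hP => ?_⟩
  have h1 := P.1.mul_norm_sq_le_energy hω le_rfl
  have h2 := P.2.mul_norm_sq_le_energy hω le_rfl
  rw [show P.2.1.1 0 = (τ : 𝕜) * P.1.1.1 0 from hP, norm_mul, RCLike.norm_ofReal, mul_pow,
    sq_abs] at h2
  have h3 : v * ‖P.1.1.1 0‖ ^ 2 ≤ v / (√ω * (1 + τ ^ 2)) * (energy ω P.1 + energy ω P.2) := by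
    rw [div_mul_eq_mul_div, le_div_iff₀ hs]
    nlinarith
  rw [quadForm]
  linarith

/-- The infimum of the quadratic form among normalized matching pairs. -/
noncomputable def nehariLevel (𝕜 : Type*) [RCLike 𝕜] (p τ v ω : ℝ) : ℝ :=
  sInf (quadForm v ω '' {P : HalfLineH1 𝕜 × HalfLineH1 𝕜 | Matching τ P ∧ mass p P = 1})

theorem nonempty_matching {p τ : ℝ} (hp : 2 ≤ p) :
    {P : HalfLineH1 𝕜 × HalfLineH1 𝕜 | Matching τ P ∧ mass p P = 1}.Nonempty := by
  obtain ⟨F, h0, hF⟩ := nonempty_dirichlet (𝕜 := 𝕜) hp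
  refine ⟨(F, 0), ?_, ?_⟩
  · change (0 : 𝕜) = (τ : 𝕜) * F.1.1 0
    rw [h0, mul_zero]
  · have : powInt p (0 : HalfLineH1 𝕜) = 0 := by
      change ∫ x in Ioi 0, ‖(0 : 𝕜)‖ ^ p = 0
      simp [Real.zero_rpow (by linarith : p ≠ 0)]
    rw [mass, hF, this, add_zero]

/-- A normalized pair has energy bounded below, as functions of small energy have small mass. -/
theorem exists_pos_le_quadForm {p τ v ω : ℝ} (hp : 2 < p) (hv : 0 < v) (hω : 0 < ω)
    (hvω : v < √ω * (1 + τ ^ 2)) :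
    ∃ c > 0, ∀ P : HalfLineH1 𝕜 × HalfLineH1 𝕜, Matching τ P → mass p P = 1 →
      c ≤ quadForm v ω P := by
  obtain ⟨c, hc, h⟩ := exists_powInt_lt_of_energy_le (𝕜 := 𝕜) hp hω (by norm_num : (0 : ℝ) < 1 / 2)
  obtain ⟨κ, hκ, hco⟩ := Matching.exists_coercive (𝕜 := 𝕜) hv hω hvω
  refine ⟨κ * c, by positivity, fun P hP hm => le_trans ?_ (hco P hP)⟩
  gcongr
  have e1 := energy_nonneg hω.le P.1
  have e2 := energy_nonneg hω.le P.2
  by_contra! hlt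
  have h1 := h P.1 (by linarith)
  have h2 := h P.2 (by linarith)
  rw [mass] at hm
  linarith

theorem bddBelow_matching {p τ v ω : ℝ} (hp : 2 < p) (hv : 0 < v) (hω : 0 < ω)
    (hvω : v < √ω * (1 + τ ^ 2)) :
    BddBelow (quadForm v ω '' {P : HalfLineH1 𝕜 × HalfLineH1 𝕜 | Matching τ P ∧ mass p P = 1}) := by
  obtain ⟨c, -, h⟩ := exists_pos_le_quadForm (𝕜 := 𝕜) hp hv hω hvω
  exact ⟨c, by rintro _ ⟨P, ⟨h1, h2⟩, rfl⟩; exact h P h1 h2⟩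

theorem nehariLevel_pos {p τ v ω : ℝ} (hp : 2 < p) (hv : 0 < v) (hω : 0 < ω)
    (hvω : v < √ω * (1 + τ ^ 2)) : 0 < nehariLevel 𝕜 p τ v ω := by
  obtain ⟨c, hc, h⟩ := exists_pos_le_quadForm (𝕜 := 𝕜) hp hv hω hvω
  refine hc.trans_le (le_csInf ((nonempty_matching hp.le).image _) ?_)
  rintro _ ⟨P, ⟨h1, h2⟩, rfl⟩
  exact h P h1 h2

theorem nehariLevel_mul_le {p τ v ω : ℝ} (hp : 2 < p) (hv : 0 < v) (hω : 0 < ω)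
    (hvω : v < √ω * (1 + τ ^ 2)) {P : HalfLineH1 𝕜 × HalfLineH1 𝕜} (hP : Matching τ P) :
    nehariLevel 𝕜 p τ v ω * mass p P ^ (2 / p) ≤ quadForm v ω P := by
  rcases (mass_nonneg p P).eq_or_lt with hm | hm
  · rw [← hm, Real.zero_rpow (by positivity), mul_zero]
    obtain ⟨κ, hκ, hco⟩ := Matching.exists_coercive (𝕜 := 𝕜) hv hω hvω
    exact (mul_nonneg hκ.le (add_nonneg (energy_nonneg hω.le _) (energy_nonneg hω.le _))).trans
      (hco P hP)
  set m := mass p P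
  have h : nehariLevel 𝕜 p τ v ω ≤ quadForm v ω (((m ^ (-(1 / p)) : ℝ) : 𝕜) • P) := by
    refine csInf_le (bddBelow_matching hp hv hω hvω) (mem_image_of_mem _ ⟨hP.smul _, ?_⟩)
    rw [mass_smul, RCLike.norm_ofReal]
    exact rpow_neg_inv_rpow_mul (by linarith) hm
  rw [quadForm_smul, RCLike.norm_ofReal] at h
  calc nehariLevel 𝕜 p τ v ω * m ^ (2 / p)
      ≤ |m ^ (-(1 / p))| ^ 2 * quadForm v ω P * m ^ (2 / p) := by gcongr
    _ = (|m ^ (-(1 / p))| ^ 2 * m ^ (2 / p)) * quadForm v ω P := by ring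
    _ = quadForm v ω P := by rw [rpow_neg_inv_sq_mul hm, one_mul]

/-- The power mean inequality for `1` and `τ`. -/
theorem half_one_add_sq_le {p : ℝ} (hp : 2 ≤ p) (τ : ℝ) :
    (1 + τ ^ 2) / 2 ≤ ((1 + |τ| ^ p) / 2) ^ (2 / p) := by
  have h := (convexOn_rpow (show 1 ≤ p / 2 by linarith)).2 (mem_Ici.2 zero_le_one)
    (mem_Ici.2 (sq_nonneg τ)) (show (0 : ℝ) ≤ 1 / 2 by norm_num) (show (0 : ℝ) ≤ 1 / 2 by norm_num)
    (by norm_num)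
  simp only [smul_eq_mul] at h
  have e : (τ ^ 2) ^ (p / 2) = |τ| ^ p := by
    rw [← sq_abs, ← Real.rpow_natCast, ← Real.rpow_mul (abs_nonneg τ)]
    congr 1
    push_cast
    ring
  rw [e, Real.one_rpow] at h
  have h2 := Real.rpow_le_rpow (by positivity) h (show 0 ≤ 2 / p by positivity)
  rw [← Real.rpow_mul (by positivity), show p / 2 * (2 / p) = 1 by field_simp, Real.rpow_one] at h2
  convert h2 using 2 <;> ring

/-- The coupled level lies strictly below the level of functions vanishing at the vertex. Given a
nearly optimal function for the latter, one of its halves `G` gives the trial pair `(G, τ G)`, whose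
quotient is at most that of the original function, minus a positive multiple of `|G(0)|²`. If the
levels agreed, then `G(0)` would tend to zero, and `G` would be asymptotically an admissible function
of half the mass and half the energy, which strict concavity of `m ↦ m ^ (2 / p)` forbids. -/
theorem nehariLevel_lt_dirichletLevel {p τ v ω : ℝ} (hp : 2 < p) (hv : 0 < v) (hω : 0 < ω)
    (hvω : v < √ω * (1 + τ ^ 2)) : nehariLevel 𝕜 p τ v ω < dirichletLevel 𝕜 p ω := by
  by_contra! hle
  set D := dirichletLevel 𝕜 p ω with hD
  have hDpos : 0 < D := dirichletLevel_pos hp hω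
  have hex : ∀ n : ℕ, ∃ G : HalfLineH1 𝕜, powInt p G = 1 / 2 ∧
      energy ω G ≤ (D + 1 / ((n : ℝ) + 1)) / 2 := fun n => by
    obtain ⟨_, ⟨F, ⟨h0, hF⟩, rfl⟩, hlt⟩ := exists_lt_of_csInf_lt
      ((nonempty_dirichlet (𝕜 := 𝕜) hp.le).image (energy ω))
      (show D < D + 1 / ((n : ℝ) + 1) from lt_add_of_pos_right _ (by positivity))
    obtain ⟨G, hG, hE⟩ := exists_half (ω := ω) hp.le h0 hF
    exact ⟨G, hG, hE.trans (by linarith)⟩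
  choose G hG hE using hex
  have htrial : ∀ n, ‖(G n).1.1 0‖ ^ 2 ≤ (1 + τ ^ 2) / (2 * v) * (1 / ((n : ℝ) + 1)) := fun n => by
    have h := nehariLevel_mul_le hp hv hω hvω (P := (G n, (τ : 𝕜) • G n)) rfl
    simp only [mass, quadForm, powInt_smul, energy_smul, hG, RCLike.norm_ofReal, sq_abs] at h
    have h2 : D * ((1 + τ ^ 2) / 2) ≤
        nehariLevel 𝕜 p τ v ω * (1 / 2 + |τ| ^ p * (1 / 2)) ^ (2 / p) := by
      have := half_one_add_sq_le hp.le τ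
      rw [show (1 + |τ| ^ p) / 2 = 1 / 2 + |τ| ^ p * (1 / 2) by ring] at this
      have := hDpos.le.trans hle
      gcongr
    have h3 := mul_le_mul_of_nonneg_left (hE n) (show 0 ≤ 1 + τ ^ 2 by positivity)
    rw [div_mul_eq_mul_div, le_div_iff₀ (by positivity)]
    linarith
  have hlim : Tendsto (fun n : ℕ => 1 / ((n : ℝ) + 1)) atTop (𝓝 0) :=
    tendsto_one_div_add_atTop_nhds_zero_nat
  have h0 : Tendsto (fun n => (G n).1.1 0) atTop (𝓝 0) := by
    rw [tendsto_zero_iff_norm_tendsto_zero]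
    have h1 : Tendsto (fun n => ‖(G n).1.1 0‖ ^ 2) atTop (𝓝 0) := by
      have := hlim.const_mul ((1 + τ ^ 2) / (2 * v))
      rw [mul_zero] at this
      exact squeeze_zero (fun n => by positivity) htrial this
    have := h1.sqrt
    simpa using this
  have hB : ∀ n, energy ω (G n) ≤ D + 1 := fun n => (hE n).trans (by
    have : 1 / ((n : ℝ) + 1) ≤ 1 := by
      rw [div_le_one (by positivity)]
      linarith [(Nat.cast_nonneg n : (0 : ℝ) ≤ n)]
    linarith)
  obtain ⟨w, hw0, hwE, hwP⟩ := exists_zero_boundary hp hω hB h0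
  have hl : Tendsto (fun n => D * powInt p (w n) ^ (2 / p)) atTop (𝓝 (D * (1 / 2) ^ (2 / p))) := by
    have h1 : Tendsto (fun n => powInt p (w n)) atTop (𝓝 (1 / 2)) := by
      have := hwP.add_const (1 / 2)
      simpa [hG] using this
    exact (h1.rpow_const (Or.inr (by positivity))).const_mul D
  have hr : Tendsto (fun n : ℕ => energy ω (w n) - energy ω (G n) + (D + 1 / ((n : ℝ) + 1)) / 2)
      atTop (𝓝 (D / 2)) := by
    have := hwE.add ((hlim.const_add D).div_const 2)
    simpa using this
  have hfin := le_of_tendsto_of_tendsto' hl hr fun n =>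
    (dirichletLevel_mul_le hp hω (hw0 n)).trans (by linarith [hE n])
  have hgt : (1 / 2 : ℝ) < (1 / 2) ^ (2 / p) := by
    have := Real.rpow_lt_rpow_of_exponent_gt (show (0 : ℝ) < 1 / 2 by norm_num) (by norm_num)
      (show 2 / p < 1 by rw [div_lt_one (by linarith)]; exact hp)
    rwa [Real.rpow_one] at this
  nlinarith

/-! ### Existence of minimizers -/

/-- The coupled level is attained: along a minimizing sequence the mass that escapes costs at least
`dirichletLevel`, so by concavity none escapes. -/
theorem exists_minimizer {p τ v ω : ℝ} (hp : 2 < p) (hv : 0 < v) (hω : 0 < ω)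
    (hvω : v < √ω * (1 + τ ^ 2)) :
    ∃ P : HalfLineH1 𝕜 × HalfLineH1 𝕜, Matching τ P ∧ mass p P = 1 ∧
      quadForm v ω P = nehariLevel 𝕜 p τ v ω := by
  set C := nehariLevel 𝕜 p τ v ω with hC
  set D := dirichletLevel 𝕜 p ω with hD
  have hCpos : 0 < C := nehariLevel_pos hp hv hω hvω
  have hCD : C < D := nehariLevel_lt_dirichletLevel hp hv hω hvω
  have hp2 : 0 ≤ 2 / p := by positivity
  have hp2' : 2 / p ≤ 1 := by
    rw [div_le_one (by linarith)]
    exact hp.le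
  have hex : ∀ n : ℕ, ∃ P : HalfLineH1 𝕜 × HalfLineH1 𝕜, Matching τ P ∧ mass p P = 1 ∧
      quadForm v ω P ≤ C + 1 / ((n : ℝ) + 1) := fun n => by
    obtain ⟨_, ⟨P, ⟨h1, h2⟩, rfl⟩, hlt⟩ := exists_lt_of_csInf_lt
      ((nonempty_matching (𝕜 := 𝕜) (τ := τ) hp.le).image (quadForm v ω))
      (show C < C + 1 / ((n : ℝ) + 1) from lt_add_of_pos_right _ (by positivity))
    exact ⟨P, h1, h2, hlt.le⟩
  choose P hPm hP1 hPq using hex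
  obtain ⟨κ, hκ, hco⟩ := Matching.exists_coercive (𝕜 := 𝕜) hv hω hvω
  have hB : ∀ n, energy ω (P n).1 + energy ω (P n).2 ≤ (C + 1) / κ := fun n => by
    rw [le_div_iff₀ hκ, mul_comm]
    refine (hco _ (hPm n)).trans ((hPq n).trans ?_)
    have : 1 / ((n : ℝ) + 1) ≤ 1 := by
      rw [div_le_one (by positivity)]
      linarith [(Nat.cast_nonneg n : (0 : ℝ) ≤ n)]
    linarith
  have hB1 : ∀ n, energy ω (P n).1 ≤ (C + 1) / κ := fun n => by
    linarith [hB n, energy_nonneg hω.le (P n).2]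
  have hB2 : ∀ n, energy ω (P n).2 ≤ (C + 1) / κ := fun n => by
    linarith [hB n, energy_nonneg hω.le (P n).1]
  -- extract on the left half first, then on the right half along the subsequence obtained
  obtain ⟨F₁, φ, hφ, ht₁, hE₁, hM₁⟩ := exists_subseq_splitting hp.le hω hB1
  obtain ⟨F₂, ψ, hψ, ht₂, hE₂, hM₂⟩ := exists_subseq_splitting hp.le hω fun n => hB2 (φ n)
  replace ht₁ := ht₁.comp hψ.tendsto_atTop
  replace hE₁ := hE₁.comp hψ.tendsto_atTop
  replace hM₁ := hM₁.comp hψ.tendsto_atTop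
  simp only [Function.comp_def] at ht₁ hE₁ hM₁
  set u₁ : ℕ → HalfLineH1 𝕜 := fun n => (P (φ (ψ n))).1 with hu₁
  set u₂ : ℕ → HalfLineH1 𝕜 := fun n => (P (φ (ψ n))).2 with hu₂
  have hmatch : Matching τ (F₁, F₂) := by
    refine tendsto_nhds_unique ht₂ ((ht₁.const_mul (τ : 𝕜)).congr fun n => ?_)
    exact (hPm (φ (ψ n))).symm
  have hzero : ∀ {u : ℕ → HalfLineH1 𝕜} {F : HalfLineH1 𝕜}, (∀ n, energy ω (u n) ≤ (C + 1) / κ) →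
      Tendsto (fun n => (u n).1.1 0) atTop (𝓝 (F.1.1 0)) →
      ∃ w : ℕ → HalfLineH1 𝕜, (∀ n, (w n).1.1 0 = 0) ∧
        Tendsto (fun n => energy ω (w n) - energy ω (u n - F)) atTop (𝓝 0) ∧
        Tendsto (fun n => powInt p (w n) - powInt p (u n - F)) atTop (𝓝 0) := fun {u F} hu ht => by
    refine exists_zero_boundary (B := 2 * ((C + 1) / κ) + 2 * energy ω F) hp hω
      (fun n => (energy_sub_le hω.le _ _).trans (by linarith [hu n])) ?_
    have := ht.sub_const (F.1.1 0)
    rwa [sub_self] at this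
  obtain ⟨w₁, hw₁, hwE₁, hwM₁⟩ := hzero (fun n => hB1 _) ht₁
  obtain ⟨w₂, hw₂, hwE₂, hwM₂⟩ := hzero (fun n => hB2 _) ht₂
  set θ := mass p (F₁, F₂) with hθ
  have hθ0 : 0 ≤ θ := mass_nonneg _ _
  have hmass : Tendsto (fun n => powInt p (w₁ n) + powInt p (w₂ n)) atTop (𝓝 (1 - θ)) := by
    have h := ((hwM₁.add hwM₂).sub (hM₁.add hM₂)).add_const (1 - θ)
    simp only [add_zero, sub_zero, zero_add] at h
    refine h.congr fun n => ?_
    have h1 : powInt p (u₁ n) + powInt p (u₂ n) = 1 := hP1 (φ (ψ n))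
    have h2 : powInt p F₁ + powInt p F₂ = θ := rfl
    simp only [hu₁, hu₂] at h1 ⊢
    linarith
  have hθ1 : θ ≤ 1 := by
    have := ge_of_tendsto' hmass fun n =>
      add_nonneg (powInt_nonneg p (w₁ n)) (powInt_nonneg p (w₂ n))
    linarith
  -- the remainder is bounded below by the level `D`; the energy splitting turns this into
  -- `D (1 - θ) ^ (2 / p) + Q(F₁, F₂) ≤ C`
  have hl : Tendsto (fun n => D * (powInt p (w₁ n) + powInt p (w₂ n)) ^ (2 / p)) atTop
      (𝓝 (D * (1 - θ) ^ (2 / p))) := (hmass.rpow_const (Or.inr hp2)).const_mul D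
  have hlim : Tendsto (fun n : ℕ => 1 / (((φ (ψ n) : ℕ) : ℝ) + 1)) atTop (𝓝 0) :=
    (tendsto_one_div_add_atTop_nhds_zero_nat (𝕜 := ℝ)).comp (hφ.comp hψ).tendsto_atTop
  have hr : Tendsto (fun n => (energy ω (w₁ n) - energy ω (u₁ n - F₁))
      + (energy ω (w₂ n) - energy ω (u₂ n - F₂))
      - ((energy ω (u₁ n) - energy ω F₁ - energy ω (u₁ n - F₁))
        + (energy ω (u₂ n) - energy ω F₂ - energy ω (u₂ n - F₂)))
      + v * (‖(u₁ n).1.1 0‖ ^ 2 - ‖F₁.1.1 0‖ ^ 2) + (C + 1 / (((φ (ψ n) : ℕ) : ℝ) + 1)))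
      atTop (𝓝 C) := by
    have h := (((hwE₁.add hwE₂).sub (hE₁.add hE₂)).add
      ((((ht₁.norm).pow 2).sub_const (‖F₁.1.1 0‖ ^ 2)).const_mul v)).add (hlim.const_add C)
    simpa using h
  have hsum : D * (1 - θ) ^ (2 / p) ≤ C - quadForm v ω (F₁, F₂) := by
    refine le_of_tendsto_of_tendsto' hl (hr.sub_const _) fun n => ?_
    have h1 := dirichletLevel_mul_le hp hω (hw₁ n)
    have h2 := dirichletLevel_mul_le hp hω (hw₂ n)
    have h3 := mul_le_mul_of_nonneg_left (Real.rpow_add_le_add_rpow (powInt_nonneg p (w₁ n))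
      (powInt_nonneg p (w₂ n)) hp2 hp2') (hCpos.trans hCD).le
    have h4 : energy ω (u₁ n) + energy ω (u₂ n) - v * ‖(u₁ n).1.1 0‖ ^ 2 ≤ _ := hPq (φ (ψ n))
    have h5 : quadForm v ω (F₁, F₂) = energy ω F₁ + energy ω F₂ - v * ‖F₁.1.1 0‖ ^ 2 := rfl
    rw [mul_add] at h3
    linarith
  have hlow := nehariLevel_mul_le hp hv hω hvω hmatch
  rw [← hC, ← hθ] at hlow
  have hconc : 1 ≤ θ ^ (2 / p) + (1 - θ) ^ (2 / p) := by
    have := Real.rpow_add_le_add_rpow hθ0 (sub_nonneg.2 hθ1) hp2 hp2'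
    rwa [add_sub_cancel, Real.one_rpow] at this
  have hnn : 0 ≤ (1 - θ) ^ (2 / p) := Real.rpow_nonneg (sub_nonneg.2 hθ1) _
  have hz : (1 - θ) ^ (2 / p) = 0 := by
    refine le_antisymm ?_ hnn
    by_contra! hpos
    nlinarith
  have hone : θ = 1 := by
    have := (Real.rpow_eq_zero (sub_nonneg.2 hθ1) (by positivity)).1 hz
    linarith
  refine ⟨(F₁, F₂), hmatch, hone, le_antisymm ?_ ?_⟩
  · rw [hz, mul_zero] at hsum
    linarith
  · rwa [hone, Real.one_rpow, mul_one] at hlow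

/-- Rescaling a minimizer puts it on the Nehari set, where it has the least mass. -/
theorem exists_nehari_minimizer {p τ v ω : ℝ} (hp : 2 < p) (hv : 0 < v) (hω : 0 < ω)
    (hvω : v < √ω * (1 + τ ^ 2)) :
    ∃ P : HalfLineH1 𝕜 × HalfLineH1 𝕜, Matching τ P ∧ 0 < mass p P ∧ quadForm v ω P = mass p P ∧
      ∀ R : HalfLineH1 𝕜 × HalfLineH1 𝕜, Matching τ R → 0 < mass p R →
        quadForm v ω R = mass p R → mass p P ≤ mass p R := by
  obtain ⟨P, hP, hm, hq⟩ := exists_minimizer (𝕜 := 𝕜) hp hv hω hvω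
  have hCpos : 0 < nehariLevel 𝕜 p τ v ω := nehariLevel_pos hp hv hω hvω
  set C := nehariLevel 𝕜 p τ v ω with hC
  have hp2 : 0 < p - 2 := by linarith
  set t := C ^ (1 / (p - 2)) with ht
  have htpos : 0 < t := by positivity
  have htp : t ^ (p - 2) = C := by
    rw [ht, ← Real.rpow_mul hCpos.le, one_div_mul_cancel hp2.ne', Real.rpow_one]
  have hmass : mass p ((t : 𝕜) • P) = t ^ p := by
    rw [mass_smul, hm, mul_one, RCLike.norm_ofReal, abs_of_pos htpos]
  refine ⟨(t : 𝕜) • P, hP.smul _, by rw [hmass]; positivity, ?_, fun R hR hRm hRq => ?_⟩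
  · rw [hmass, quadForm_smul, hq, RCLike.norm_ofReal, abs_of_pos htpos, ← htp,
      ← Real.rpow_natCast, ← Real.rpow_add htpos]
    congr 1
    push_cast
    ring
  · rw [hmass]
    have h := nehariLevel_mul_le hp hv hω hvω hR
    rw [← hC, hRq] at h
    set m := mass p R
    have h1 : C ≤ m ^ ((p - 2) / p) := by
      have e : m = m ^ ((p - 2) / p) * m ^ (2 / p) := by
        rw [← Real.rpow_add hRm, ← add_div, sub_add_cancel, div_self (by linarith), Real.rpow_one]
      have h2 : C * m ^ (2 / p) ≤ m ^ ((p - 2) / p) * m ^ (2 / p) := h.trans_eq e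
      exact le_of_mul_le_mul_right h2 (by positivity)
    calc t ^ p = C ^ (p / (p - 2)) := by
          rw [ht, ← Real.rpow_mul hCpos.le]
          congr 1
          field_simp
      _ ≤ (m ^ ((p - 2) / p)) ^ (p / (p - 2)) := by
          gcongr
      _ = m := by
          rw [← Real.rpow_mul hRm.le, div_mul_div_cancel₀ (by linarith), div_self hp2.ne',
            Real.rpow_one]

/-! ### Weak derivatives on the half-line -/

/-- A primitive of a square integrable function has that function as its weak derivative. -/
theorem isWeakDeriv_of_primitive {f g : ℝ → 𝕜} (hg : MemLp g 2 (volume.restrict (Ioi 0)))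
    (hf : ∀ x, 0 ≤ x → f x = f 0 + ∫ t in (0 : ℝ)..x, g t) : IsWeakDeriv (Ioi 0) f g := by
  intro φ hφ hc hs
  obtain ⟨b, hb⟩ := hc.isCompact.bddAbove
  set B := max b 0 + 1
  have hbB : b < B := by
    have := le_max_left b 0
    simp only [B]
    linarith
  have hB : 0 ≤ B := by
    have := le_max_right b 0
    simp only [B]
    linarith
  have z : ∀ x, x ∉ tsupport φ → φ x = 0 ∧ deriv φ x = 0 := fun x hx =>
    ⟨image_eq_zero_of_notMem_tsupport hx,
      image_eq_zero_of_notMem_tsupport fun h => hx (tsupport_deriv_subset h)⟩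
  have z0 := z 0 fun h => lt_irrefl (0 : ℝ) (hs h)
  have zB : ∀ x, B ≤ x → φ x = 0 ∧ deriv φ x = 0 := fun x hx =>
    z x fun h => by linarith [hb h]
  have hgi := intervalIntegrable_of_memLp hg le_rfl hB
  have h := integral_deriv_smul_add_smul_primitive (hφ.of_le (by simp)) hB hgi
    fun x hx => hf x hx.1
  rw [z0.1, (zB B le_rfl).1, zero_smul, zero_smul, sub_zero] at h
  have red : ∀ k : ℝ → 𝕜, (∀ x, B ≤ x → k x = 0) → ∫ x in Ioi 0, k x = ∫ x in (0 : ℝ)..B, k x :=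
    fun k hk => by
      rw [intervalIntegral.integral_of_le hB]
      refine (setIntegral_eq_of_subset_of_forall_sdiff_eq_zero measurableSet_Ioi
        Ioc_subset_Ioi_self fun x hx => hk x ?_)
      by_contra! hlt
      exact hx.2 ⟨hx.1, hlt.le⟩
  rw [red _ fun x hx => by rw [(zB x hx).2, zero_smul],
    red _ fun x hx => by rw [(zB x hx).1, zero_smul]]
  have hfc : ContinuousOn f (uIcc 0 B) := by
    rw [uIcc_of_le hB]
    have := (absolutelyContinuousOnInterval_primitive hgi left_mem_uIcc).continuousOn
    rw [uIcc_of_le hB] at this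
    exact (this.const_add (f 0)).congr fun x hx => hf x hx.1
  have hi : IntervalIntegrable (fun x => deriv φ x • f x) volume 0 B :=
    ((hφ.continuous_deriv (by simp)).continuousOn.smul hfc).intervalIntegrable
  rw [intervalIntegral.integral_add hi (hgi.continuousOn_smul hφ.continuous.continuousOn)] at h
  exact eq_neg_of_add_eq_zero_left h

/-- The lemma of du Bois-Reymond on the half-line. -/
theorem ae_eq_const_of_integral_deriv_smul_eq_zero {h : ℝ → 𝕜}
    (hl : LocallyIntegrable h (volume.restrict (Ioi 0)))
    (hh : ∀ φ : ℝ → ℝ, ContDiff ℝ (⊤ : ℕ∞) φ → HasCompactSupport φ → tsupport φ ⊆ Ioi 0 →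
      ∫ x in Ioi 0, deriv φ x • h x = 0) :
    ∃ c : 𝕜, h =ᵐ[volume.restrict (Ioi 0)] fun _ => c := by
  let β : ContDiffBump (2 : ℝ) := ⟨1 / 2, 1, by norm_num, by norm_num⟩
  set ψ : ℝ → ℝ := β.normed volume
  have hψ : ContDiff ℝ (⊤ : ℕ∞) ψ := β.contDiff_normed
  have hψc : HasCompactSupport ψ := β.hasCompactSupport_normed
  have hψs : tsupport ψ ⊆ Ioi 0 := by
    rw [show tsupport ψ = Metric.closedBall 2 1 from β.tsupport_normed_eq, Real.closedBall_eq_Icc]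
    intro x hx
    have := hx.1
    exact lt_of_lt_of_le (by norm_num) this
  have hψ1 : ∫ x, ψ x = 1 := β.integral_normed
  have hψne : (tsupport ψ).Nonempty := by
    rw [show tsupport ψ = Metric.closedBall 2 1 from β.tsupport_normed_eq]
    exact ⟨2, by simp⟩
  have setInt : ∀ φ : ℝ → ℝ, tsupport φ ⊆ Ioi 0 → ∫ x in Ioi 0, φ x = ∫ x, φ x := fun φ hs =>
    setIntegral_eq_integral_of_forall_compl_eq_zero fun x hx =>
      image_eq_zero_of_notMem_tsupport fun h => hx (hs h)
  have int : ∀ φ : ℝ → ℝ, Continuous φ → HasCompactSupport φ →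
      Integrable (fun x => φ x • h x) (volume.restrict (Ioi 0)) := fun φ h1 h2 =>
    hl.integrable_smul_left_of_hasCompactSupport h1 h2
  refine ⟨∫ x in Ioi 0, ψ x • h x, ?_⟩
  set c := ∫ x in Ioi 0, ψ x • h x
  have key : ∀ᵐ x ∂(volume.restrict (Ioi (0 : ℝ))), x ∈ Ioi (0 : ℝ) → h x - c = 0 := by
    refine isOpen_Ioi.ae_eq_zero_of_integral_contDiff_smul_eq_zero
      ((hl.sub (locallyIntegrable_const c)).locallyIntegrableOn _) fun φ hφ hφc hφs => ?_
    set m := ∫ x, φ x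
    -- `φ - m ψ` has zero mean, so its primitive is again a test function
    set θ : ℝ → ℝ := fun x => φ x - m * ψ x
    have hθ : ContDiff ℝ (⊤ : ℕ∞) θ := hφ.sub (contDiff_const.mul hψ)
    have hK : IsCompact (tsupport φ ∪ tsupport ψ) := hφc.isCompact.union hψc.isCompact
    have hKne : (tsupport φ ∪ tsupport ψ).Nonempty := hψne.mono subset_union_right
    obtain ⟨a, haK, ha⟩ := hK.exists_isLeast hKne
    obtain ⟨b, -, hb⟩ := hK.exists_isGreatest hKne
    have ha0 : 0 < a := (union_subset hφs hψs) haK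
    have hθz : ∀ x, x ∉ Icc a b → θ x = 0 := fun x hx => by
      have hxK : x ∉ tsupport φ ∪ tsupport ψ := fun h => hx ⟨ha h, hb h⟩
      rw [mem_union, not_or] at hxK
      simp [θ, image_eq_zero_of_notMem_tsupport hxK.1, image_eq_zero_of_notMem_tsupport hxK.2]
    have hθi : ∫ x, θ x = 0 := by
      rw [integral_sub (hφ.continuous.integrable_of_hasCompactSupport hφc)
        ((hψ.continuous.integrable_of_hasCompactSupport hψc).const_mul m), integral_const_mul, hψ1,
        mul_one, sub_self]
    set Φ : ℝ → ℝ := fun x => ∫ t in a..x, θ t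
    have hΦd : ∀ x, HasDerivAt Φ (θ x) x := fun x =>
      intervalIntegral.integral_hasDerivAt_right (hθ.continuous.intervalIntegrable _ _)
        (hθ.continuous.stronglyMeasurableAtFilter _ _) hθ.continuous.continuousAt
    have hΦ' : deriv Φ = θ := funext fun x => (hΦd x).deriv
    have hΦ : ContDiff ℝ (⊤ : ℕ∞) Φ := by
      rw [contDiff_infty_iff_deriv]
      exact ⟨fun x => (hΦd x).differentiableAt, hΦ' ▸ hθ⟩
    have hΦz : ∀ x, x ∉ Icc a b → Φ x = 0 := fun x hx => by
      rcases lt_or_ge x a with hxa | hxa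
      · simp only [Φ]
        rw [intervalIntegral.integral_symm, intervalIntegral.integral_of_le hxa.le,
          integral_Ioc_eq_integral_Ioo,
          setIntegral_eq_zero_of_forall_eq_zero fun t ht => hθz t fun h => not_lt.2 h.1 ht.2,
          neg_zero]
      · have hxb : b < x := by
          by_contra! hle
          exact hx ⟨hxa, hle⟩
        simp only [Φ]
        rw [intervalIntegral.integral_of_le hxa, ← integral_Icc_eq_integral_Ioc, ← hθi]
        exact setIntegral_eq_integral_of_forall_compl_eq_zero fun t ht =>
          hθz t fun h => ht ⟨h.1, h.2.trans hxb.le⟩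
    have hΦs : tsupport Φ ⊆ Icc a b := closure_minimal (fun x hx => by
      by_contra hn
      exact hx (hΦz x hn)) isClosed_Icc
    have h1 := hh Φ hΦ (HasCompactSupport.of_support_subset_isCompact isCompact_Icc
      (subset_closure.trans hΦs)) (hΦs.trans fun x hx => ha0.trans_le hx.1)
    rw [hΦ'] at h1
    have h2 : ∫ x in Ioi 0, θ x • h x = (∫ x in Ioi 0, φ x • h x) - m • c := by
      simp only [θ, sub_smul, mul_smul]
      have hm : Integrable (fun x => m • ψ x • h x) (volume.restrict (Ioi 0)) :=
        (int ψ hψ.continuous hψc).smul m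
      rw [integral_sub (int φ hφ.continuous hφc) hm, integral_smul]
    have h3 : ∫ x in Ioi 0, φ x • c = m • c := by
      rw [integral_smul_const, setInt φ hφs]
    have h4 : Integrable (fun x => φ x • c) (volume.restrict (Ioi 0)) :=
      (hφ.continuous.integrable_of_hasCompactSupport hφc).integrableOn.smul_const c
    simp only [smul_sub]
    rw [integral_sub (int φ hφ.continuous hφc) h4, h3, ← h2, h1]
  filter_upwards [key, ae_restrict_mem measurableSet_Ioi] with x hx hm
  exact sub_eq_zero.1 (hx hm)

/-- Every Sobolev function on the half-line has a continuous representative in `HalfLineH1`. -/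
theorem MemH1.exists_halfLineH1 {u : ℝ → 𝕜} (hu : MemH1 (Ioi 0) u) :
    ∃ F : HalfLineH1 𝕜, u =ᵐ[volume.restrict (Ioi 0)] F.1.1 := by
  obtain ⟨hu2, g, hg, hw⟩ := hu
  set f : ℝ → 𝕜 := fun x => ∫ t in (0 : ℝ)..x, g t
  have hfw : IsWeakDeriv (Ioi 0) f g := isWeakDeriv_of_primitive hg fun x _ => by simp [f]
  have hfi : ∀ x, 0 ≤ x → ContinuousOn f (Icc 0 x) := fun x hx => by
    have := (absolutelyContinuousOnInterval_primitive
      (intervalIntegrable_of_memLp hg le_rfl hx) left_mem_uIcc).continuousOn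
    rwa [uIcc_of_le hx] at this
  have hfl : LocallyIntegrable f (volume.restrict (Ioi 0)) := by
    refine locallyIntegrable_iff.2 fun K hK => ?_
    obtain ⟨b, hb⟩ := hK.bddAbove
    have hi : IntegrableOn f (Icc 0 (max b 0)) :=
      (hfi _ (le_max_right _ _)).integrableOn_Icc
    rw [IntegrableOn, Measure.restrict_restrict hK.measurableSet]
    exact hi.mono_set fun x hx => ⟨le_of_lt hx.2, (hb hx.1).trans (le_max_left _ _)⟩
  have hul := hu2.locallyIntegrable (by norm_num)
  obtain ⟨c, hc⟩ := ae_eq_const_of_integral_deriv_smul_eq_zero (hul.sub hfl)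
    fun φ hφ hφc hφs => by
      have hd := hφ.continuous_deriv (by simp)
      simp only [Pi.sub_apply, smul_sub]
      rw [integral_sub (hul.integrable_smul_left_of_hasCompactSupport hd hφc.deriv)
        (hfl.integrable_smul_left_of_hasCompactSupport hd hφc.deriv), hw φ hφ hφc hφs,
        hfw φ hφ hφc hφs, sub_self]
  have huf : u =ᵐ[volume.restrict (Ioi 0)] fun x => c + f x := by
    filter_upwards [hc] with x hx
    rw [← hx]
    simp
  exact ⟨⟨(fun x => c + f x, g), (memLp_congr_ae huf).1 hu2, hg, fun x _ => by simp [f]⟩, huf⟩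

theorem IsWeakDeriv.congr_ae {Ω : Set ℝ} {u u' g : ℝ → 𝕜} (h : IsWeakDeriv Ω u g)
    (hu : u =ᵐ[volume.restrict Ω] u') : IsWeakDeriv Ω u' g := fun φ h1 h2 h3 => by
  rw [← h φ h1 h2 h3]
  refine integral_congr_ae ?_
  filter_upwards [hu] with x hx
  rw [hx]

/-! ### Reflection of the negative half-line -/

theorem measurePreserving_neg_restrict {Ω Ω' : Set ℝ} (hΩ : MeasurableSet Ω)
    (h : Ω' = (fun x => -x) ⁻¹' Ω) :
    MeasurePreserving (fun x : ℝ => -x) (volume.restrict Ω') (volume.restrict Ω) :=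
  h ▸ (Measure.measurePreserving_neg volume).restrict_preimage hΩ

theorem Ioi_zero_eq_preimage_neg : Ioi (0 : ℝ) = (fun x => -x) ⁻¹' Iio 0 := by
  ext x
  simp

theorem Iio_zero_eq_preimage_neg : Iio (0 : ℝ) = (fun x => -x) ⁻¹' Ioi 0 := by
  ext x
  simp

theorem setIntegral_comp_neg {E : Type*} [NormedAddCommGroup E] [NormedSpace ℝ E] {Ω Ω' : Set ℝ}
    (hΩ : MeasurableSet Ω) (h : Ω' = (fun x => -x) ⁻¹' Ω) (k : ℝ → E) :
    ∫ x in Ω', k (-x) = ∫ x in Ω, k x :=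
  (measurePreserving_neg_restrict hΩ h).integral_comp
    (Homeomorph.neg ℝ).isClosedEmbedding.measurableEmbedding k

theorem IsWeakDeriv.comp_neg {Ω Ω' : Set ℝ} (hΩ : MeasurableSet Ω) (h : Ω' = (fun x => -x) ⁻¹' Ω)
    {u g : ℝ → 𝕜} (hu : IsWeakDeriv Ω u g) :
    IsWeakDeriv Ω' (fun x => u (-x)) (fun x => -g (-x)) := by
  intro φ hφ hc hs
  have h1 := hu (fun x => φ (-x)) (hφ.comp contDiff_neg)
    (hc.comp_homeomorph (Homeomorph.neg ℝ)) (by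
      intro x hx
      have e : tsupport (fun x => φ (-x)) = (fun x => -x) ⁻¹' tsupport φ :=
        tsupport_comp_eq_preimage φ (Homeomorph.neg ℝ)
      rw [e] at hx
      have h2 := hs hx
      rw [h] at h2
      simpa using h2)
  have h2 := setIntegral_comp_neg hΩ h fun x => deriv (fun y => φ (-y)) x • u x
  have h3 := setIntegral_comp_neg hΩ h fun x => φ (-x) • g x
  rw [← h2, ← h3] at h1
  simp only [deriv_comp_neg, neg_neg, neg_smul, integral_neg, neg_inj] at h1
  simp only [smul_neg, integral_neg, neg_neg]
  exact h1

theorem HasTrace.comp_neg {Ω Ω' : Set ℝ} (hΩ : MeasurableSet Ω) (h : Ω' = (fun x => -x) ⁻¹' Ω)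
    {u : ℝ → 𝕜} {c : 𝕜} (hu : HasTrace Ω u 0 c) : HasTrace Ω' (fun x => u (-x)) 0 c := by
  obtain ⟨w, hw, hae, ht⟩ := hu
  have hmaps : MapsTo (fun x : ℝ => -x) Ω' Ω := fun x hx => by
    rw [h] at hx
    exact hx
  refine ⟨fun x => w (-x), hw.comp continuous_neg.continuousOn hmaps,
    (measurePreserving_neg_restrict hΩ h).quasiMeasurePreserving.ae_eq_comp hae, ?_⟩
  refine ht.comp (tendsto_nhdsWithin_iff.2 ⟨?_, ?_⟩)
  · have := (continuous_neg (G := ℝ)).tendsto 0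
    rw [neg_zero] at this
    exact this.mono_left nhdsWithin_le_nhds
  · filter_upwards [self_mem_nhdsWithin] with x hx using hmaps hx

theorem MemH1.comp_neg {Ω Ω' : Set ℝ} (hΩ : MeasurableSet Ω) (h : Ω' = (fun x => -x) ⁻¹' Ω)
    {u : ℝ → 𝕜} (hu : MemH1 Ω u) : MemH1 Ω' (fun x => u (-x)) := by
  obtain ⟨hu2, g, hg, hw⟩ := hu
  have hm := measurePreserving_neg_restrict hΩ h
  exact ⟨hu2.comp_measurePreserving hm, _, (hg.comp_measurePreserving hm).neg, hw.comp_neg hΩ h⟩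

/-! ### Functions on the line as pairs of functions on the half-line -/

theorem HalfLineH1.isWeakDeriv {F : HalfLineH1 𝕜} {u : ℝ → 𝕜}
    (hu : u =ᵐ[volume.restrict (Ioi 0)] F.1.1) : IsWeakDeriv (Ioi 0) u F.1.2 :=
  (isWeakDeriv_of_primitive F.memLp_deriv fun _ hx => F.eq_add_integral hx).congr_ae hu.symm

theorem HalfLineH1.memH1 {F : HalfLineH1 𝕜} {u : ℝ → 𝕜}
    (hu : u =ᵐ[volume.restrict (Ioi 0)] F.1.1) : MemH1 (Ioi 0) u :=
  ⟨(memLp_congr_ae hu).2 F.memLp, F.1.2, F.memLp_deriv, F.isWeakDeriv hu⟩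

theorem HalfLineH1.hasTrace {F : HalfLineH1 𝕜} {u : ℝ → 𝕜}
    (hu : u =ᵐ[volume.restrict (Ioi 0)] F.1.1) : HasTrace (Ioi 0) u 0 (F.1.1 0) :=
  ⟨F.1.1, F.continuousOn.mono Ioi_subset_Ici_self, hu,
    (F.continuousOn 0 self_mem_Ici).mono_left (nhdsWithin_mono _ Ioi_subset_Ici_self)⟩

/-- The pair `P` represents `u`: its first component is the reflection of `u` on the negative
half-line, its second component is `u` on the positive half-line. -/
def Represents (P : HalfLineH1 𝕜 × HalfLineH1 𝕜) (u : ℝ → 𝕜) : Prop :=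
  (fun x => u (-x)) =ᵐ[volume.restrict (Ioi 0)] P.1.1.1 ∧ u =ᵐ[volume.restrict (Ioi 0)] P.2.1.1

namespace Represents

variable {P : HalfLineH1 𝕜 × HalfLineH1 𝕜} {u : ℝ → 𝕜}

theorem isWeakDeriv_left (h : Represents P u) :
    IsWeakDeriv (Iio 0) u (fun x => -P.1.1.2 (-x)) := by
  have := (HalfLineH1.isWeakDeriv h.1).comp_neg measurableSet_Ioi Iio_zero_eq_preimage_neg
  simpa using this

theorem memLp_deriv_left (P : HalfLineH1 𝕜 × HalfLineH1 𝕜) :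
    MemLp (fun x => -P.1.1.2 (-x)) 2 (volume.restrict (Iio 0)) :=
  (P.1.memLp_deriv.comp_measurePreserving
    (measurePreserving_neg_restrict measurableSet_Ioi Iio_zero_eq_preimage_neg)).neg

theorem memH1_left (h : Represents P u) : MemH1 (Iio 0) u := by
  have := (HalfLineH1.memH1 h.1).comp_neg measurableSet_Ioi Iio_zero_eq_preimage_neg
  simpa using this

theorem hasTrace_left (h : Represents P u) : HasTrace (Iio 0) u 0 (P.1.1.1 0) := by
  have := (HalfLineH1.hasTrace h.1).comp_neg measurableSet_Ioi Iio_zero_eq_preimage_neg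
  simpa using this

theorem leftValue_eq (h : Represents P u) : leftValue u = P.1.1.1 0 :=
  h.hasTrace_left.trace_eq isOpen_Iio (by simp)

theorem mem_H1tau (h : Represents P u) {τ : ℝ} (hP : Matching τ P) : u ∈ H1tau 𝕜 τ := by
  refine ⟨h.memH1_left, HalfLineH1.memH1 h.2, P.1.1.1 0, h.hasTrace_left, ?_⟩
  rw [← show P.2.1.1 0 = (τ : 𝕜) * P.1.1.1 0 from hP]
  exact HalfLineH1.hasTrace h.2

theorem kinetic_eq (h : Represents P u) :
    kinetic u = (∫ x in Ioi 0, ‖P.1.1.2 x‖ ^ 2) + ∫ x in Ioi 0, ‖P.2.1.2 x‖ ^ 2 := by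
  rw [kinetic]
  congr 1
  · rw [← setIntegral_comp_neg measurableSet_Ioi Iio_zero_eq_preimage_neg]
    refine integral_congr_ae ?_
    filter_upwards [weakDeriv_ae_eq isOpen_Iio (memLp_deriv_left P) h.isWeakDeriv_left] with x hx
    rw [hx, norm_neg]
  · refine integral_congr_ae ?_
    filter_upwards [weakDeriv_ae_eq isOpen_Ioi P.2.memLp_deriv
      (HalfLineH1.isWeakDeriv h.2)] with x hx
    rw [hx]

theorem integral_eq (h : Represents P u) (k : ℝ → ℝ)
    (h₁ : IntegrableOn (fun x => k ‖P.1.1.1 x‖) (Ioi 0))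
    (h₂ : IntegrableOn (fun x => k ‖P.2.1.1 x‖) (Ioi 0)) :
    ∫ x, k ‖u x‖ = (∫ x in Ioi 0, k ‖P.1.1.1 x‖) + ∫ x in Ioi 0, k ‖P.2.1.1 x‖ := by
  have e₁ : (fun x => k ‖P.1.1.1 x‖) =ᵐ[volume.restrict (Ioi 0)] fun x => k ‖u (-x)‖ := by
    filter_upwards [h.1] with x hx
    rw [hx]
  have e₂ : (fun x => k ‖P.2.1.1 x‖) =ᵐ[volume.restrict (Ioi 0)] fun x => k ‖u x‖ := by
    filter_upwards [h.2] with x hx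
    rw [hx]
  have i₁ : IntegrableOn (fun x => k ‖u x‖) (Iio 0) := by
    have := (measurePreserving_neg_restrict measurableSet_Ioi
      Iio_zero_eq_preimage_neg).integrable_comp_of_integrable (h₁.congr e₁)
    simpa [Function.comp_def, IntegrableOn] using this
  have i₂ : IntegrableOn (fun x => k ‖u x‖) (Ioi 0) := h₂.congr e₂
  rw [← intervalIntegral.integral_Iic_add_Ioi (b := 0) (i₁.congr_set_ae Iio_ae_eq_Iic.symm)
    i₂, integral_Iic_eq_integral_Iio, integral_congr_ae e₁, integral_congr_ae e₂,
    setIntegral_comp_neg measurableSet_Iio Ioi_zero_eq_preimage_neg fun x => k ‖u x‖]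

theorem integral_sq_eq (h : Represents P u) :
    ∫ x, ‖u x‖ ^ 2 = (∫ x in Ioi 0, ‖P.1.1.1 x‖ ^ 2) + ∫ x in Ioi 0, ‖P.2.1.1 x‖ ^ 2 :=
  h.integral_eq (fun y => y ^ 2) P.1.integrable_sq P.2.integrable_sq

theorem integral_rpow_eq (h : Represents P u) {p : ℝ} (hp : 2 ≤ p) :
    ∫ x, ‖u x‖ ^ p = mass p P :=
  h.integral_eq (fun y => y ^ p) (P.1.integrable_rpow hp) (P.2.integrable_rpow hp)

theorem nehari_eq (h : Represents P u) {p : ℝ} (hp : 2 ≤ p) (v ω : ℝ) :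
    nehari p v ω u = quadForm v ω P - mass p P := by
  rw [nehari, h.integral_rpow_eq hp, h.integral_sq_eq, h.kinetic_eq, h.leftValue_eq, quadForm,
    energy_eq, energy_eq]
  ring

theorem action_eq (h : Represents P u) {p : ℝ} (hp : 2 ≤ p) (v ω : ℝ) :
    action p v ω u = (1 / 2) * quadForm v ω P - (1 / p) * mass p P := by
  rw [action, h.integral_rpow_eq hp, h.integral_sq_eq, h.kinetic_eq, h.leftValue_eq, quadForm,
    energy_eq, energy_eq]
  ring

theorem ae_eq_zero (h : Represents P u) {p : ℝ} (hp : 2 ≤ p) (hm : mass p P = 0) :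
    u =ᵐ[volume] 0 := by
  have n₁ := powInt_nonneg p P.1
  have n₂ := powInt_nonneg p P.2
  rw [mass] at hm
  have r : u =ᵐ[volume.restrict (Ioi 0)] 0 := by
    filter_upwards [h.2, ae_restrict_mem measurableSet_Ioi] with x hx hx0
    rw [hx, eq_zero_of_powInt_eq_zero hp (by linarith) hx0, Pi.zero_apply]
  have l : (fun x => u (-x)) =ᵐ[volume.restrict (Ioi 0)] 0 := by
    filter_upwards [h.1, ae_restrict_mem measurableSet_Ioi] with x hx hx0
    rw [hx, eq_zero_of_powInt_eq_zero hp (by linarith) hx0, Pi.zero_apply]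
  have l' : u =ᵐ[volume.restrict (Iio 0)] 0 := by
    have := (measurePreserving_neg_restrict measurableSet_Ioi
      Iio_zero_eq_preimage_neg).quasiMeasurePreserving.ae_eq_comp l
    simpa [Function.comp_def] using! this
  have hne : ∀ᵐ x : ℝ, x ≠ 0 := by simp [ae_iff]
  have r' := (ae_restrict_iff' measurableSet_Ioi).1 r
  have l'' := (ae_restrict_iff' measurableSet_Iio).1 l'
  filter_upwards [r', l'', hne] with x h1 h2 h3
  exact (lt_or_gt_of_ne h3).elim h2 h1

end Represents

theorem exists_represents_of_mem_H1tau {τ : ℝ} {u : ℝ → 𝕜} (hu : u ∈ H1tau 𝕜 τ) :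
    ∃ P : HalfLineH1 𝕜 × HalfLineH1 𝕜, Represents P u ∧ Matching τ P := by
  obtain ⟨hl, hr, c, hcl, hcr⟩ := hu
  obtain ⟨F, hF⟩ := (hl.comp_neg measurableSet_Iio Ioi_zero_eq_preimage_neg).exists_halfLineH1
  obtain ⟨G, hG⟩ := hr.exists_halfLineH1
  have h : Represents (F, G) u := ⟨hF, hG⟩
  refine ⟨(F, G), h, ?_⟩
  have e1 := HasTrace.unique isOpen_Iio (by simp) h.hasTrace_left hcl
  have e2 := HasTrace.unique isOpen_Ioi (by simp) (HalfLineH1.hasTrace h.2) hcr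
  change G.1.1 0 = (τ : 𝕜) * F.1.1 0
  rw [e2, ← e1]

theorem exists_represents (P : HalfLineH1 𝕜 × HalfLineH1 𝕜) : ∃ u, Represents P u := by
  refine ⟨fun x => if 0 < x then P.2.1.1 x else P.1.1.1 (-x), ?_, ?_⟩
  · filter_upwards [ae_restrict_mem measurableSet_Ioi] with x hx
    rw [if_neg (by simpa using le_of_lt hx), neg_neg]
  · filter_upwards [ae_restrict_mem measurableSet_Ioi] with x hx
    exact if_pos hx

theorem exists_isMinOn_action {p τ v ω : ℝ} (hp : 2 < p) (hv : 0 < v)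
    (hω : v ^ 2 / (τ ^ 2 + 1) ^ 2 < ω) :
    ∃ u ∈ nehariSet 𝕜 p τ v ω, IsMinOn (action p v ω) (nehariSet 𝕜 p τ v ω) u := by
  have hω0 : 0 < ω := lt_of_le_of_lt (by positivity) hω
  have hvω : v < √ω * (1 + τ ^ 2) := by
    rw [← div_pow] at hω
    have h := Real.lt_sqrt_of_sq_lt hω
    rwa [div_lt_iff₀ (by positivity), add_comm] at h
  obtain ⟨P, hP, hm, hq, hmin⟩ := exists_nehari_minimizer (𝕜 := 𝕜) hp hv hω0 hvω
  obtain ⟨u, hu⟩ := exists_represents P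
  refine ⟨u, ⟨hu.mem_H1tau hP, fun h0 => hm.ne' ?_, ?_⟩, fun w hw => ?_⟩
  · rw [← hu.integral_rpow_eq hp.le, ← integral_zero ℝ ℝ (μ := volume)]
    refine integral_congr_ae ?_
    filter_upwards [h0] with x hx
    simp [hx, Real.zero_rpow (by linarith : p ≠ 0)]
  · rw [hu.nehari_eq hp.le, hq, sub_self]
  · obtain ⟨hwτ, hw0, hwn⟩ := hw
    obtain ⟨R, hR, hRm⟩ := exists_represents_of_mem_H1tau hwτ
    rw [hR.nehari_eq hp.le, sub_eq_zero] at hwn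
    have hRpos : 0 < mass p R :=
      (mass_nonneg p R).lt_of_ne' fun h => hw0 (hR.ae_eq_zero hp.le h)
    have hle := hmin R hRm hRpos hwn
    have hc : 0 ≤ 1 / 2 - 1 / p := by
      rw [sub_nonneg]
      exact one_div_le_one_div_of_le two_pos hp.le
    change action p v ω u ≤ action p v ω w
    rw [hu.action_eq hp.le, hR.action_eq hp.le, hq, hwn, ← sub_mul, ← sub_mul]
    gcongr

end Sobolev

end FulopTsutsui

theorem mainTheorem1 (𝕜 : Type*) [RCLike 𝕜] (p τ v ω : ℝ) (hp : 2 < p)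
    (hτ0 : τ ≠ 0) (hτ1 : τ ≠ 1) (hv : 0 < v) (hω : v ^ 2 / (τ ^ 2 + 1) ^ 2 < ω) :
    ∃ u ∈ FulopTsutsui.nehariSet 𝕜 p τ v ω,
      IsMinOn (FulopTsutsui.action p v ω) (FulopTsutsui.nehariSet 𝕜 p τ v ω) u :=
  FulopTsutsui.exists_isMinOn_action hp hv hω
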